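/- Let $\alpha<\beta$ be elements of $\mathbb{R}\cup\{-\infty,+\infty\}$, not both infinite. For $X\subseteq\mathbb{Z}^2$ let $\mathcal{H}_X\subseteq \ell^2(\mathbb{Z}^2)$ be the closed span of the basis vectors $e_p$, $p\in X$, and $P_X$ the orthogonal projection of $\ell^2(\mathbb{Z}^2)$ onto $\mathcal{H}_X$. For $(m,n)\in\mathbb{Z}^2$ let $M_{m,n}$ be the translation $(M_{m,n}\varphi)(k,l)=\varphi(k-m,l-n)$, and let $\mathcal{T}_X\subseteq B(\mathcal{H}_X)$ be the $C^*$-algebra generated by the compressions $P_XM_{m,n}P_X$, $(m,n)\in\mathbb{Z}^2$. Put $$\Sigma^\alpha=\{(x,y)\in\mathbb{Z}^2\mid -\alpha x+y\ge 0\},\qquad \Sigma^\beta=\{(x,y)\in\mathbb{Z}^2\mid -\beta x+y\le 0\},\qquad \check\Sigma=\Sigma^\alpha\cup\Sigma^\beta,$$ where $\Sigma^{\alpha}$ for $\alpha=-\infty$, respectively $\Sigma^{\beta}$ for $\beta=+\infty$, means $\{(x,y)\in\mathbb{Z}^2\mid x\ge 0\}$. Write $\mathcal{T}^\alpha$, $\mathcal{T}^\beta$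 and $\check{\mathcal{T}}^{\alpha,\beta}$ (the concave corner Toeplitz algebra) for $\mathcal{T}_X$ with $X=\Sigma^\alpha,\Sigma^\beta,\check\Sigma$, and $P^\alpha,P^\beta,\check P^{\alpha,\beta}$ for the corresponding projections. Let $\sigma^\alpha:\mathcal{T}^\alpha\to C(\mathbb{T}^2)$ and $\sigma^\beta:\mathcal{T}^\beta\to C(\mathbb{T}^2)$ be the $*$-homomorphisms sending $P^\alpha M_{m,n}P^\alpha$, respectively $P^\beta M_{m,n}P^\beta$, to the function $(\xi,\eta)\mapsto\xi^m\eta^n$, and let $$\mathcal{S}^{\alpha,\beta}=\{(A,B)\in\mathcal{T}^\alpha\oplus\mathcal{T}^\beta\mid \sigma^\alpha(A)=\sigma^\beta(B)\}.$$ Let $\check\gamma^\alpha:\check{\mathcal{T}}^{\alpha,\beta}\to\mathcal{T}^\alpha$ and $\check\gamma^\beta:\check{\mathcal{T}}^{\alpha,\beta}\to\mathcal{T}^\beta$ be the $*$-homomorphisms sending $\check P^{\alpha,\beta}M_{m,n}\check P^{\alpha,\beta}$ to $P^\alpha M_{m,n}P^\alpha$ and to $P^\beta M_{m,n}P^\beta$,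 respectively, and let $\check\gamma=(\check\gamma^\alpha,\check\gamma^\beta):\check{\mathcal{T}}^{\alpha,\beta}\to\mathcal{S}^{\alpha,\beta}$. **Theorem.** An operator $\check T\in\check{\mathcal{T}}^{\alpha,\beta}$ is Fredholm (as an operator on $\mathcal{H}_{\check\Sigma}$) if and only if $\check\gamma(\check T)$ is invertible in $\mathcal{S}^{\alpha,\beta}$; moreover, $\check\gamma(\check T)$ is invertible in $\mathcal{S}^{\alpha,\beta}$ if and only if $\check\gamma^\alpha(\check T)$ and $\check\gamma^\beta(\check T)$ are invertible in $\mathcal{T}^\alpha$ and $\mathcal{T}^\beta$, respectively. -/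

import Mathlib

open Filter Topology
open scoped ENNReal InnerProductSpace

noncomputable section

namespace ConcaveCorner

/-! ### The Hilbert space of square summable functions on the lattice and its translations -/

/-- The Hilbert space `ℓ²(ℤ²)` of complex square summable functions. -/
abbrev LatticeL2 : Type := lp (fun _ : ℤ × ℤ => ℂ) 2

/-- The standard basis vector `e_p`, equal to `1` at `p` and to `0` elsewhere. -/
def basisVec (p : ℤ × ℤ) : LatticeL2 := lp.single 2 p (1 : ℂ)

theorem memlp_translate (p : ℤ × ℤ) (f : LatticeL2) :
    Memℓp (fun k : ℤ × ℤ => f (k - p)) 2 := by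
  have h2 : 0 < (2 : ℝ≥0∞).toReal := by norm_num
  have h := (lp.memℓp f).summable h2
  exact memℓp_gen ((Equiv.subRight p).summable_iff.mpr h)

theorem norm_translate (p : ℤ × ℤ) (f : LatticeL2) :
    ‖(⟨fun k => f (k - p), memlp_translate p f⟩ : LatticeL2)‖ = ‖f‖ := by
  have h2 : 0 < (2 : ℝ≥0∞).toReal := by norm_num
  rw [lp.norm_eq_tsum_rpow h2, lp.norm_eq_tsum_rpow h2]
  congr 1
  exact (Equiv.subRight p).tsum_eq (fun k => ‖f k‖ ^ (2 : ℝ≥0∞).toReal)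

/-- The translation operator `M_p`, given by `(M_p f) k = f (k - p)`. -/
def translation (p : ℤ × ℤ) : LatticeL2 →L[ℂ] LatticeL2 :=
  LinearMap.mkContinuous
    { toFun := fun f => ⟨fun k => f (k - p), memlp_translate p f⟩
      map_add' := fun _ _ => rfl
      map_smul' := fun _ _ => rfl } 1
    (fun f => by rw [one_mul]; exact (norm_translate p f).le)

theorem translation_apply (p : ℤ × ℤ) (f : LatticeL2) (k : ℤ × ℤ) :
    translation p f k = f (k - p) := rfl

theorem norm_translation_apply (p : ℤ × ℤ) (f : LatticeL2) : ‖translation p f‖ = ‖f‖ :=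
  norm_translate p f

theorem translation_basisVec (p q : ℤ × ℤ) :
    translation p (basisVec q) = basisVec (q + p) := by
  ext k
  rw [translation_apply]
  by_cases h : k = q + p
  · subst h; simp [basisVec]
  · have h' : k - p ≠ q := fun h' => h (by rw [← h']; abel)
    rw [basisVec, basisVec, lp.single_apply_ne _ _ _ h', lp.single_apply_ne _ _ _ h]

theorem translation_comm (p q : ℤ × ℤ) (f : LatticeL2) :
    translation p (translation q f) = translation q (translation p f) := by
  ext k
  simp only [translation_apply]
  rw [sub_right_comm]

theorem adjoint_translation (p : ℤ × ℤ) :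
    ContinuousLinearMap.adjoint (translation p) = translation (-p) := by
  symm
  rw [ContinuousLinearMap.eq_adjoint_iff]
  intro f g
  rw [lp.inner_eq_tsum, lp.inner_eq_tsum]
  rw [← (Equiv.subRight p).tsum_eq]
  congr 1
  funext k
  simp [translation_apply]

/-! ### Subspaces attached to subsets of the lattice, and their Toeplitz algebras -/

/-- The closed subspace of `ℓ²(ℤ²)` spanned by the basis vectors `e_p` with `p ∈ X`. -/
def regionSubmodule (X : Set (ℤ × ℤ)) : Submodule ℂ LatticeL2 :=
  (Submodule.span ℂ (basisVec '' X)).topologicalClosure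

/-- The closed subspace attached to `X`, as a Hilbert space with the inherited inner product. -/
def RegionSpace (X : Set (ℤ × ℤ)) : Type := regionSubmodule X

instance (X : Set (ℤ × ℤ)) : NormedAddCommGroup (RegionSpace X) :=
  inferInstanceAs (NormedAddCommGroup (regionSubmodule X))

instance (X : Set (ℤ × ℤ)) : InnerProductSpace ℂ (RegionSpace X) :=
  inferInstanceAs (InnerProductSpace ℂ (regionSubmodule X))

instance (X : Set (ℤ × ℤ)) : CompleteSpace (regionSubmodule X) :=
  (Submodule.isClosed_topologicalClosure _).completeSpace_coe

instance (X : Set (ℤ × ℤ)) : CompleteSpace (RegionSpace X) :=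
  inferInstanceAs (CompleteSpace (regionSubmodule X))

/-- The inclusion of the subspace attached to `X` into `ℓ²(ℤ²)`. -/
def incl (X : Set (ℤ × ℤ)) : RegionSpace X →L[ℂ] LatticeL2 := (regionSubmodule X).subtypeL

/-- The orthogonal projection of `ℓ²(ℤ²)` onto the subspace attached to `X`. -/
def proj (X : Set (ℤ × ℤ)) : LatticeL2 →L[ℂ] RegionSpace X :=
  (regionSubmodule X).orthogonalProjectionOnto

/-- The compression `P M_p P` of a translation, as an operator on the subspace attached to `X`;
here `P` is the orthogonal projection onto that subspace. -/
def compression (X : Set (ℤ × ℤ)) (p : ℤ × ℤ) : RegionSpace X →L[ℂ] RegionSpace X :=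
  proj X ∘L translation p ∘L incl X

/-- The Toeplitz C*-algebra of `X`: the C*-subalgebra of the bounded operators on the subspace
attached to `X` that is generated by the compressions of all translations. -/
def toeplitzAlgebra (X : Set (ℤ × ℤ)) :
    StarSubalgebra ℂ (RegionSpace X →L[ℂ] RegionSpace X) :=
  (StarAlgebra.adjoin ℂ (Set.range (compression X))).topologicalClosure

/-- The compression of a translation as an element of the Toeplitz algebra. -/
def toeplitzGen (X : Set (ℤ × ℤ)) (p : ℤ × ℤ) : toeplitzAlgebra X :=
  ⟨compression X p, StarSubalgebra.le_topologicalClosure _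
    (StarAlgebra.subset_adjoin ℂ _ ⟨p, rfl⟩)⟩

theorem adjoint_incl (X : Set (ℤ × ℤ)) : ContinuousLinearMap.adjoint (incl X) = proj X :=
  Submodule.adjoint_subtypeL (regionSubmodule X)

theorem adjoint_proj (X : Set (ℤ × ℤ)) : ContinuousLinearMap.adjoint (proj X) = incl X :=
  Submodule.adjoint_orthogonalProjectionOnto (regionSubmodule X)

theorem star_compression (X : Set (ℤ × ℤ)) (p : ℤ × ℤ) :
    star (compression X p) = compression X (-p) := by
  rw [ContinuousLinearMap.star_eq_adjoint, compression, ContinuousLinearMap.adjoint_comp,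
    ContinuousLinearMap.adjoint_comp, adjoint_translation, adjoint_incl, adjoint_proj, compression,
    ContinuousLinearMap.comp_assoc]

theorem norm_incl (X : Set (ℤ × ℤ)) (f : RegionSpace X) : ‖incl X f‖ = ‖f‖ := rfl

theorem norm_proj_le (X : Set (ℤ × ℤ)) (f : LatticeL2) : ‖proj X f‖ ≤ ‖f‖ :=
  (regionSubmodule X).norm_orthogonalProjectionOnto_apply_le f

theorem basisVec_mem {X : Set (ℤ × ℤ)} {p : ℤ × ℤ} (hp : p ∈ X) :
    basisVec p ∈ regionSubmodule X :=
  Submodule.le_topologicalClosure _ (Submodule.subset_span ⟨p, hp, rfl⟩)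

theorem inner_basisVec (p q : ℤ × ℤ) (h : p ≠ q) : ⟪basisVec p, basisVec q⟫_ℂ = 0 := by
  rw [basisVec, lp.inner_single_left, basisVec, lp.single_apply_ne _ _ _ h]
  simp

theorem incl_proj_of_mem {X : Set (ℤ × ℤ)} {f : LatticeL2} (hf : f ∈ regionSubmodule X) :
    incl X (proj X f) = f :=
  congrArg Subtype.val (Submodule.orthogonalProjectionOnto_mem_subspace_eq_self
    (⟨f, hf⟩ : regionSubmodule X))

theorem proj_basisVec_of_notMem {X : Set (ℤ × ℤ)} {p : ℤ × ℤ} (hp : p ∉ X) :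
    proj X (basisVec p) = 0 := by
  change (regionSubmodule X).orthogonalProjectionOnto (basisVec p) = 0
  rw [Submodule.orthogonalProjectionOnto_eq_zero_iff, regionSubmodule, Submodule.orthogonal_closure,
    Submodule.mem_orthogonal]
  intro u hu
  induction hu using Submodule.span_induction with
  | mem x hx =>
    obtain ⟨q, hq, rfl⟩ := hx
    exact inner_basisVec q p (fun h => hp (h ▸ hq))
  | zero => simp
  | add x y _ _ hx hy => rw [inner_add_left, hx, hy, add_zero]
  | smul c x _ hx => rw [inner_smul_left, hx, mul_zero]

/-! ### Extending a contractive assignment on generators to a `*`-homomorphism -/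

section Extension

variable {A B ι : Type*} [CStarAlgebra A] [CStarAlgebra B] (a : ι → A) (b : ι → B)

/-- The graph: the C*-subalgebra of `A × B` generated by the pairs `(a i, b i)`. -/
def genGraph : StarSubalgebra ℂ (A × B) :=
  (StarAlgebra.adjoin ℂ (Set.range fun i => (a i, b i))).topologicalClosure

variable {a b}

theorem genGraph_mem (i : ι) : (a i, b i) ∈ genGraph a b :=
  StarSubalgebra.le_topologicalClosure _ (StarAlgebra.subset_adjoin ℂ _ ⟨i, rfl⟩)

theorem genGraph_norm_le
    (h : ∀ z ∈ StarAlgebra.adjoin ℂ (Set.range fun i => (a i, b i)), ‖z.2‖ ≤ ‖z.1‖)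
    {z : A × B} (hz : z ∈ genGraph a b) : ‖z.2‖ ≤ ‖z.1‖ := by
  have hc : IsClosed {z : A × B | ‖z.2‖ ≤ ‖z.1‖} :=
    isClosed_le continuous_snd.norm continuous_fst.norm
  exact closure_minimal (fun z hz => h z hz) hc hz

theorem genGraph_exists
    (h : ∀ z ∈ StarAlgebra.adjoin ℂ (Set.range fun i => (a i, b i)), ‖z.2‖ ≤ ‖z.1‖)
    (x : (StarAlgebra.adjoin ℂ (Set.range a)).topologicalClosure) :
    ∃ y : B, ((x : A), y) ∈ genGraph a b := by
  have hcl : IsClosed (((genGraph a b).map (StarAlgHom.fst ℂ A B) : StarSubalgebra ℂ A) : Set A) := by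
    have hG : IsClosed (genGraph a b : Set (A × B)) :=
      StarSubalgebra.isClosed_topologicalClosure _
    have : CompleteSpace (genGraph a b) := hG.completeSpace_coe
    have hanti : AntilipschitzWith 1 (fun z : genGraph a b => (z : A × B).1) := by
      refine AntilipschitzWith.of_le_mul_dist fun z w => ?_
      have h1 := genGraph_norm_le h (z - w).2
      rw [NNReal.coe_one, one_mul, Subtype.dist_eq, dist_eq_norm, dist_eq_norm, Prod.norm_def]
      exact max_le le_rfl h1
    have hu : UniformContinuous (fun z : genGraph a b => (z : A × B).1) :=
      uniformContinuous_fst.comp uniformContinuous_subtype_val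
    have hr := hanti.isClosed_range hu
    convert hr using 1
    ext x
    simp
  have hle : (StarAlgebra.adjoin ℂ (Set.range a)).topologicalClosure ≤
      (genGraph a b).map (StarAlgHom.fst ℂ A B) := by
    refine StarSubalgebra.topologicalClosure_minimal ?_ hcl
    refine StarAlgebra.adjoin_le ?_
    rintro _ ⟨i, rfl⟩
    exact ⟨(a i, b i), genGraph_mem i, rfl⟩
  obtain ⟨z, hz, hzx⟩ := hle x.2
  exact ⟨z.2, by rw [← hzx]; exact hz⟩

theorem genGraph_unique
    (h : ∀ z ∈ StarAlgebra.adjoin ℂ (Set.range fun i => (a i, b i)), ‖z.2‖ ≤ ‖z.1‖)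
    {x : A} {y y' : B} (hy : (x, y) ∈ genGraph a b) (hy' : (x, y') ∈ genGraph a b) : y = y' := by
  have := genGraph_norm_le h (sub_mem hy hy')
  simpa [sub_eq_zero] using this

/-- If the pairs `(a i, b i)` satisfy the norm inequality `h` on all `*`-polynomials, then this is
the (unique) `*`-homomorphism on the C*-algebra generated by the `a i` with `a i ↦ b i`. -/
def extendHom
    (h : ∀ z ∈ StarAlgebra.adjoin ℂ (Set.range fun i => (a i, b i)), ‖z.2‖ ≤ ‖z.1‖) :
    (StarAlgebra.adjoin ℂ (Set.range a)).topologicalClosure →⋆ₐ[ℂ] B where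
  toFun x := (genGraph_exists h x).choose
  map_one' := genGraph_unique h (genGraph_exists h 1).choose_spec (one_mem _)
  map_mul' x y := genGraph_unique h (genGraph_exists h (x * y)).choose_spec
    (mul_mem (genGraph_exists h x).choose_spec (genGraph_exists h y).choose_spec)
  map_zero' := genGraph_unique h (genGraph_exists h 0).choose_spec (zero_mem _)
  map_add' x y := genGraph_unique h (genGraph_exists h (x + y)).choose_spec
    (add_mem (genGraph_exists h x).choose_spec (genGraph_exists h y).choose_spec)
  commutes' r := genGraph_unique h (genGraph_exists h (algebraMap ℂ _ r)).choose_spec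
    (algebraMap_mem (genGraph a b) r)
  map_star' x := genGraph_unique h (genGraph_exists h (star x)).choose_spec
    (star_mem (genGraph_exists h x).choose_spec)

theorem extendHom_graph
    (h : ∀ z ∈ StarAlgebra.adjoin ℂ (Set.range fun i => (a i, b i)), ‖z.2‖ ≤ ‖z.1‖)
    (x : (StarAlgebra.adjoin ℂ (Set.range a)).topologicalClosure) :
    ((x : A), extendHom h x) ∈ genGraph a b := (genGraph_exists h x).choose_spec

theorem extendHom_gen
    (h : ∀ z ∈ StarAlgebra.adjoin ℂ (Set.range fun i => (a i, b i)), ‖z.2‖ ≤ ‖z.1‖)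
    (x : (StarAlgebra.adjoin ℂ (Set.range a)).topologicalClosure) (i : ι) (hx : (x : A) = a i) :
    extendHom h x = b i :=
  genGraph_unique h (extendHom_graph h x) (by rw [hx]; exact genGraph_mem i)

theorem norm_extendHom_le
    (h : ∀ z ∈ StarAlgebra.adjoin ℂ (Set.range fun i => (a i, b i)), ‖z.2‖ ≤ ‖z.1‖)
    (x : (StarAlgebra.adjoin ℂ (Set.range a)).topologicalClosure) :
    ‖extendHom h x‖ ≤ ‖x‖ := genGraph_norm_le h (extendHom_graph h x)

theorem extendHom_mem
    (h : ∀ z ∈ StarAlgebra.adjoin ℂ (Set.range fun i => (a i, b i)), ‖z.2‖ ≤ ‖z.1‖)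
    (x : (StarAlgebra.adjoin ℂ (Set.range a)).topologicalClosure) :
    extendHom h x ∈ (StarAlgebra.adjoin ℂ (Set.range b)).topologicalClosure := by
  have hcl : IsClosed {z : A × B | z.2 ∈ (StarAlgebra.adjoin ℂ (Set.range b)).topologicalClosure} :=
    (StarSubalgebra.isClosed_topologicalClosure _).preimage continuous_snd
  refine closure_minimal (fun z hz => ?_) hcl (extendHom_graph h x)
  have hle : StarAlgebra.adjoin ℂ (Set.range fun i => (a i, b i)) ≤
      ((StarAlgebra.adjoin ℂ (Set.range b)).topologicalClosure).comap (StarAlgHom.snd ℂ A B) := by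
    refine StarAlgebra.adjoin_le ?_
    rintro _ ⟨i, rfl⟩
    exact StarSubalgebra.le_topologicalClosure _ (StarAlgebra.subset_adjoin ℂ _ ⟨i, rfl⟩)
  exact hle hz

end Extension

/-- The norm inequality needed for the extension follows from asymptotically isometric,
asymptotically intertwining contractions `V t`. -/
theorem norm_le_of_intertwine {ι κ E K B : Type*} [NormedAddCommGroup K] [InnerProductSpace ℂ K]
    [CompleteSpace K] [NormedAddCommGroup E] [NormedSpace ℂ E] [CStarAlgebra B]
    (a : ι → K →L[ℂ] K) (b : ι → B) (ρ : B →ₐ[ℂ] (E →L[ℂ] E))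
    (hstar : ∀ i, ∃ j, star (a i) = a j ∧ star (b i) = b j)
    (l : Filter κ) [l.NeBot] (V : κ → E →L[ℂ] K)
    (hV : ∀ f, Tendsto (fun t => ‖V t f‖) l (𝓝 ‖f‖))
    (hgen : ∀ i f, Tendsto (fun t => a i (V t f) - V t (ρ (b i) f)) l (𝓝 0))
    {z : (K →L[ℂ] K) × B} (hz : z ∈ StarAlgebra.adjoin ℂ (Set.range fun i => (a i, b i))) :
    ‖ρ z.2‖ ≤ ‖z.1‖ := by
  have key : ∀ f, Tendsto (fun t => z.1 (V t f) - V t (ρ z.2 f)) l (𝓝 0) := by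
    have hz' : z ∈ Algebra.adjoin ℂ (Set.range fun i => (a i, b i)) := by
      have : z ∈ Algebra.adjoin ℂ ((Set.range fun i => (a i, b i)) ∪
        star (Set.range fun i => (a i, b i))) := hz
      rwa [Set.union_eq_self_of_subset_right] at this
      rintro w ⟨i, hi⟩
      obtain ⟨j, h1, h2⟩ := hstar i
      refine ⟨j, ?_⟩
      rw [← star_star w, ← hi]
      simp [Prod.star_def, h1, h2]
    clear hz
    induction hz' using Algebra.adjoin_induction with
    | mem x hx => obtain ⟨i, rfl⟩ := hx; exact hgen i
    | algebraMap r =>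
      intro f
      simp [Algebra.algebraMap_eq_smul_one]
    | add x y _ _ hx hy =>
      intro f
      have := (hx f).add (hy f)
      rw [add_zero] at this
      refine this.congr fun t => ?_
      simp
      abel
    | mul x y _ _ hx hy =>
      intro f
      have h1 := (x.1.continuous.tendsto 0).comp (hy f)
      rw [map_zero] at h1
      have := h1.add (hx (ρ y.2 f))
      rw [add_zero] at this
      refine this.congr fun t => ?_
      simp
  refine ContinuousLinearMap.opNorm_le_bound _ (norm_nonneg _) fun f => ?_
  have h1 : Tendsto (fun t => ‖z.1‖ * ‖V t f‖ + ‖z.1 (V t f) - V t (ρ z.2 f)‖) l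
      (𝓝 (‖z.1‖ * ‖f‖ + 0)) := ((hV f).const_mul _).add (by simpa using (key f).norm)
  rw [add_zero] at h1
  refine le_of_tendsto_of_tendsto' (hV (ρ z.2 f)) h1 fun t => ?_
  calc ‖V t (ρ z.2 f)‖ = ‖z.1 (V t f) - (z.1 (V t f) - V t (ρ z.2 f))‖ := by rw [sub_sub_cancel]
    _ ≤ ‖z.1 (V t f)‖ + ‖z.1 (V t f) - V t (ρ z.2 f)‖ := norm_sub_le _ _
    _ ≤ _ := by gcongr; exact z.1.le_opNorm _

/-! ### Comparing the Toeplitz algebras of two subsets of the lattice -/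

/-- Every finite configuration of lattice points can be translated in such a way that membership
of the translated points in `Y` reproduces membership of the original points in `X`. -/
def ShiftsTo (Y X : Set (ℤ × ℤ)) : Prop :=
  ∀ S : Finset (ℤ × ℤ), ∃ t : ℤ × ℤ, ∀ p ∈ S, (p + t ∈ Y ↔ p ∈ X)

theorem tendsto_zero_of_dense {κ : Type*} {l : Filter κ} {C : ℝ} {X : Set (ℤ × ℤ)}
    (D : κ → LatticeL2 →L[ℂ] LatticeL2) (hD : ∀ t f, ‖D t f‖ ≤ C * ‖f‖)
    (h : ∀ q ∈ X, Tendsto (fun t => D t (basisVec q)) l (𝓝 0)) {f : LatticeL2}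
    (hf : f ∈ regionSubmodule X) : Tendsto (fun t => D t f) l (𝓝 0) := by
  have hspan : ∀ g ∈ Submodule.span ℂ (basisVec '' X), Tendsto (fun t => D t g) l (𝓝 0) := by
    intro g hg
    induction hg using Submodule.span_induction with
    | mem x hx => obtain ⟨q, hq, rfl⟩ := hx; exact h q hq
    | zero => simpa using tendsto_const_nhds
    | add x y _ _ hx hy => simpa using hx.add hy
    | smul c x _ hx => simpa using hx.const_smul c
  rw [Metric.tendsto_nhds]
  intro ε hε
  have hf' : f ∈ closure (Submodule.span ℂ (basisVec '' X) : Set LatticeL2) := hf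
  obtain ⟨g, hg, hfg⟩ := Metric.mem_closure_iff.mp hf' (ε / (2 * (|C| + 1))) (by positivity)
  filter_upwards [(Metric.tendsto_nhds.mp (hspan g hg)) (ε / 2) (by positivity)] with t ht
  rw [dist_zero_right] at ht ⊢
  have h1 : ‖D t (f - g)‖ ≤ ε / 2 := by
    refine (hD t _).trans ?_
    rw [dist_eq_norm] at hfg
    calc C * ‖f - g‖ ≤ (|C| + 1) * (ε / (2 * (|C| + 1))) := by
          gcongr
          linarith [le_abs_self C]
      _ = ε / 2 := by field_simp
  calc ‖D t f‖ = ‖D t (f - g) + D t g‖ := by rw [← map_add, sub_add_cancel]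
    _ ≤ ‖D t (f - g)‖ + ‖D t g‖ := norm_add_le _ _
    _ < ε := by linarith

theorem ShiftsTo.norm_le {X Y : Set (ℤ × ℤ)} (h : ShiftsTo Y X) :
    ∀ z ∈ StarAlgebra.adjoin ℂ (Set.range fun p => (compression Y p, compression X p)),
      ‖z.2‖ ≤ ‖z.1‖ := by
  intro z hz
  choose t ht using h
  have hev : ∀ p, ∀ᶠ S in (atTop : Filter (Finset (ℤ × ℤ))), (p + t S ∈ Y ↔ p ∈ X) := by
    intro p
    filter_upwards [eventually_ge_atTop {p}] with S hS
    exact ht S p (hS (Finset.mem_singleton_self p))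
  have h1 : ∀ f : RegionSpace X, Tendsto (fun S => incl Y (proj Y (translation (t S) (incl X f))) -
      translation (t S) (incl X f)) atTop (𝓝 0) := by
    intro f
    refine tendsto_zero_of_dense (C := 2) (X := X) (fun S => (incl Y ∘L proj Y ∘L translation (t S)) -
      translation (t S)) (fun S g => ?_) (fun q hq => ?_) f.2
    · change ‖incl Y (proj Y (translation (t S) g)) - translation (t S) g‖ ≤ _
      refine (norm_sub_le _ _).trans ?_
      have := norm_proj_le Y (translation (t S) g)
      rw [norm_translation_apply] at this ⊢
      rw [norm_incl]
      linarith
    · refine tendsto_const_nhds.congr' ?_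
      filter_upwards [hev q] with S hS
      simp only [sub_apply, ContinuousLinearMap.comp_apply, translation_basisVec]
      rw [incl_proj_of_mem (basisVec_mem (hS.mpr hq)), sub_self]
  refine norm_le_of_intertwine (compression Y) (compression X) (AlgHom.id ℂ _)
    (fun p => ⟨-p, star_compression _ _, star_compression _ _⟩) atTop
    (fun S => proj Y ∘L translation (t S) ∘L incl X) (fun f => ?_) (fun p f => ?_) hz
  · have h2 := (h1 f).norm
    rw [norm_zero] at h2
    rw [tendsto_iff_norm_sub_tendsto_zero]
    refine squeeze_zero (fun _ => norm_nonneg _) (fun S => ?_) h2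
    have h3 := abs_norm_sub_norm_le (incl Y (proj Y (translation (t S) (incl X f))))
      (translation (t S) (incl X f))
    rwa [norm_translation_apply, norm_incl, norm_incl] at h3
  · have h2 : Tendsto (fun S => incl Y (compression Y p (proj Y (translation (t S) (incl X f)))) -
        incl Y (proj Y (translation (t S) (incl X (compression X p f))))) atTop (𝓝 0) := by
      refine tendsto_zero_of_dense (C := 2) (X := X)
        (fun S => (incl Y ∘L compression Y p ∘L proj Y ∘L translation (t S)) -
          (incl Y ∘L proj Y ∘L translation (t S) ∘L incl X ∘L proj X ∘L translation p))
        (fun S g => ?_) (fun q hq => ?_) f.2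
      · change ‖incl Y (compression Y p (proj Y (translation (t S) g))) -
          incl Y (proj Y (translation (t S) (incl X (proj X (translation p g)))))‖ ≤ _
        refine (norm_sub_le _ _).trans ?_
        have e1 : ‖incl Y (compression Y p (proj Y (translation (t S) g)))‖ ≤ ‖g‖ := by
          rw [norm_incl]
          refine (norm_proj_le _ _).trans ?_
          change ‖translation p (incl Y (proj Y (translation (t S) g)))‖ ≤ _
          rw [norm_translation_apply, norm_incl]
          refine (norm_proj_le _ _).trans ?_
          rw [norm_translation_apply]
        have e2 : ‖incl Y (proj Y (translation (t S) (incl X (proj X (translation p g)))))‖ ≤ ‖g‖ := by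
          rw [norm_incl]
          refine (norm_proj_le _ _).trans ?_
          rw [norm_translation_apply, norm_incl]
          refine (norm_proj_le _ _).trans ?_
          rw [norm_translation_apply]
        linarith
      · refine tendsto_const_nhds.congr' ?_
        filter_upwards [hev q, hev (q + p)] with S hS hS'
        simp only [compression, sub_apply, ContinuousLinearMap.comp_apply,
          translation_basisVec]
        rw [incl_proj_of_mem (basisVec_mem (hS.mpr hq)), translation_basisVec]
        have hcomm : q + t S + p = q + p + t S := by abel
        rw [hcomm]
        by_cases hqp : q + p ∈ X
        · rw [incl_proj_of_mem (X := X) (basisVec_mem hqp), translation_basisVec, sub_self]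
        · rw [proj_basisVec_of_notMem hqp, proj_basisVec_of_notMem (fun hc => hqp (hS'.mp hc))]
          simp
    rw [tendsto_zero_iff_norm_tendsto_zero] at h2 ⊢
    refine h2.congr fun S => ?_
    rw [← map_sub, norm_incl]
    rfl

/-- The `*`-homomorphism between Toeplitz algebras that sends the compression of each translation
to the subspace of `Y` to its compression to the subspace of `X`. -/
def restrictHom {X Y : Set (ℤ × ℤ)} (h : ShiftsTo Y X) :
    toeplitzAlgebra Y →⋆ₐ[ℂ] toeplitzAlgebra X :=
  StarAlgHom.codRestrict (extendHom h.norm_le) (toeplitzAlgebra X) (extendHom_mem h.norm_le)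

theorem restrictHom_gen {X Y : Set (ℤ × ℤ)} (h : ShiftsTo Y X) (p : ℤ × ℤ) :
    restrictHom h (toeplitzGen Y p) = toeplitzGen X p :=
  Subtype.ext (extendHom_gen h.norm_le (toeplitzGen Y p) p rfl)

theorem continuous_restrictHom {X Y : Set (ℤ × ℤ)} (h : ShiftsTo Y X) :
    Continuous (restrictHom h) :=
  AddMonoidHomClass.continuous_of_bound (restrictHom h) 1
    (fun x => by rw [one_mul]; exact norm_extendHom_le h.norm_le x)

/-- Continuous `*`-homomorphisms on a Toeplitz algebra are determined by their values on the
compressions of the translations. -/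
theorem toeplitz_hom_ext {X : Set (ℤ × ℤ)} {B : Type*} [CStarAlgebra B]
    {φ ψ : toeplitzAlgebra X →⋆ₐ[ℂ] B} (hφ : Continuous φ) (hψ : Continuous ψ)
    (h : ∀ p, φ (toeplitzGen X p) = ψ (toeplitzGen X p)) : φ = ψ := by
  refine StarAlgHom.ext_topologicalClosure hφ hψ ?_
  refine StarAlgHom.ext_adjoin fun x hx => ?_
  obtain ⟨p, hp⟩ := hx
  have : StarSubalgebra.inclusion (StarSubalgebra.le_topologicalClosure _) x = toeplitzGen X p :=
    Subtype.ext hp.symm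
  change φ (StarSubalgebra.inclusion (StarSubalgebra.le_topologicalClosure _) x) =
    ψ (StarSubalgebra.inclusion (StarSubalgebra.le_topologicalClosure _) x)
  rw [this]
  exact h p

/-! ### The symbol map to the continuous functions on the torus -/

/-- The two-dimensional torus. -/
abbrev Torus : Type := Circle × Circle

/-- The character `χ_{m,n}(ξ, η) = ξ ^ m * η ^ n` of the torus. -/
def torusChar (p : ℤ × ℤ) : C(Torus, ℂ) where
  toFun z := (z.1 : ℂ) ^ p.1 * (z.2 : ℂ) ^ p.2
  continuous_toFun :=
    ((continuous_subtype_val.comp continuous_fst).zpow₀ p.1 fun z => Or.inl (Circle.coe_ne_zero z.1)).mul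
      ((continuous_subtype_val.comp continuous_snd).zpow₀ p.2 fun z => Or.inl (Circle.coe_ne_zero z.2))

theorem torusChar_apply (p : ℤ × ℤ) (z : Torus) :
    torusChar p z = (z.1 : ℂ) ^ p.1 * (z.2 : ℂ) ^ p.2 := rfl

theorem norm_torusChar_apply (p : ℤ × ℤ) (z : Torus) : ‖torusChar p z‖ = 1 := by
  rw [torusChar_apply, norm_mul, norm_zpow, norm_zpow, Circle.norm_coe, Circle.norm_coe,
    one_zpow, one_zpow, one_mul]

theorem torusChar_add (p q : ℤ × ℤ) (z : Torus) :
    torusChar (p + q) z = torusChar p z * torusChar q z := by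
  simp only [torusChar_apply, Prod.fst_add, Prod.snd_add,
    zpow_add₀ (Circle.coe_ne_zero z.1), zpow_add₀ (Circle.coe_ne_zero z.2)]
  ring

theorem star_torusChar (p : ℤ × ℤ) : star (torusChar p) = torusChar (-p) := by
  ext z
  have h : torusChar p z * torusChar (-p) z = 1 := by
    rw [← torusChar_add]; simp [torusChar_apply]
  have h2 : torusChar p z * star (torusChar p z) = 1 := by
    have := RCLike.mul_conj (torusChar p z)
    rw [norm_torusChar_apply] at this
    simpa using this
  have h0 : torusChar p z ≠ 0 := left_ne_zero_of_mul_eq_one h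
  rw [ContinuousMap.star_apply]
  exact mul_left_cancel₀ h0 (h2.trans h.symm)

/-- The discrete box `[0, N) × [0, N)`. -/
def box (N : ℕ) : Finset (ℤ × ℤ) := Finset.Ico 0 (N : ℤ) ×ˢ Finset.Ico 0 (N : ℤ)

theorem box_sdiff_card (N : ℕ) (p : ℤ × ℤ) :
    ((box N).filter (fun k => k + p ∉ box N)).card ≤ (p.1.natAbs + p.2.natAbs) * N := by
  have hsub : (box N).filter (fun k => k + p ∉ box N) ⊆
      ((Finset.Ico 0 (-p.1) ∪ Finset.Ico (N - p.1) N) ×ˢ Finset.Ico 0 (N : ℤ)) ∪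
      (Finset.Ico 0 (N : ℤ) ×ˢ (Finset.Ico 0 (-p.2) ∪ Finset.Ico (N - p.2) N)) := by
    intro k hk
    simp only [box, Finset.mem_filter, Finset.mem_product, Finset.mem_Ico, Prod.fst_add,
      Prod.snd_add, Finset.mem_union] at hk ⊢
    omega
  have hc : ∀ a : ℤ, (Finset.Ico 0 (-a) ∪ Finset.Ico (N - a) (N : ℤ)).card ≤ a.natAbs := by
    intro a
    refine (Finset.card_union_le _ _).trans ?_
    simp only [Int.card_Ico]
    omega
  refine (Finset.card_le_card hsub).trans ((Finset.card_union_le _ _).trans ?_)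
  rw [Finset.card_product, Finset.card_product, Int.card_Ico]
  have h1 := hc p.1
  have h2 := hc p.2
  have h3 : ((N : ℤ) - 0).toNat = N := by omega
  rw [h3, add_mul, mul_comm N]
  gcongr

/-- Normalized plane wave of frequency `z`, cut off to a box: an approximate joint eigenvector of
all translations. -/
def planeWave (z : Torus) (N : ℕ) : LatticeL2 :=
  (N : ℂ)⁻¹ • ∑ k ∈ box N, lp.single 2 k (torusChar (-k) z)

theorem norm_sum_single_sq (S : Finset (ℤ × ℤ)) (c : ℤ × ℤ → ℂ) (hc : ∀ k, ‖c k‖ = 1) :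
    ‖(∑ k ∈ S, lp.single 2 k (c k) : LatticeL2)‖ ^ 2 = S.card := by
  have h := lp.norm_sum_single (E := fun _ : ℤ × ℤ => ℂ) (p := 2) (by norm_num) c S
  simp only [ENNReal.toReal_ofNat, Real.rpow_ofNat] at h
  rw [h]
  simp [hc]

theorem norm_planeWave (z : Torus) (N : ℕ) (hN : N ≠ 0) : ‖planeWave z N‖ = 1 := by
  have h := norm_sum_single_sq (box N) (fun k => torusChar (-k) z)
    (fun k => norm_torusChar_apply _ _)
  have hcard : (box N).card = N * N := by simp [box]
  rw [hcard, Nat.cast_mul, ← sq] at h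
  have h' := (sq_eq_sq₀ (norm_nonneg _) (Nat.cast_nonneg N)).mp h
  rw [planeWave, norm_smul, h', norm_inv, Complex.norm_natCast]
  exact inv_mul_cancel₀ (by exact_mod_cast hN)

theorem translation_single (p q : ℤ × ℤ) (c : ℂ) :
    translation p (lp.single 2 q c) = lp.single 2 (q + p) c := by
  have h : ∀ k, (lp.single 2 k c : LatticeL2) = c • basisVec k := by
    intro k
    rw [basisVec, ← lp.single_smul]
    simp
  rw [h, h, map_smul, translation_basisVec]

theorem planeWave_mem {X : Set (ℤ × ℤ)} {N : ℕ} {t : ℤ × ℤ} (h : ∀ k ∈ box N, k + t ∈ X)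
    (z : Torus) : translation t (planeWave z N) ∈ regionSubmodule X := by
  rw [planeWave, map_smul, map_sum]
  refine Submodule.smul_mem _ _ (Submodule.sum_mem _ fun k hk => ?_)
  have hs : (lp.single 2 (k + t) (torusChar (-k) z) : LatticeL2) =
      torusChar (-k) z • basisVec (k + t) := by
    rw [basisVec, ← lp.single_smul]
    simp
  rw [translation_single, hs]
  exact Submodule.smul_mem _ _ (basisVec_mem (h k hk))

theorem tendsto_planeWave (z : Torus) (p : ℤ × ℤ) :
    Tendsto (fun N => translation p (planeWave z N) - torusChar p z • planeWave z N) atTop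
      (𝓝 0) := by
  set C : ℝ := ((p.1.natAbs + p.2.natAbs : ℕ) : ℝ) with hC
  have hbound : ∀ N : ℕ, ‖translation p (planeWave z N) - torusChar p z • planeWave z N‖ ≤
      (N : ℝ)⁻¹ * (2 * Real.sqrt (C * N)) := by
    intro N
    have hdiff : translation p (planeWave z N) - torusChar p z • planeWave z N = (N : ℂ)⁻¹ •
        (∑ k ∈ (box N).filter (fun k => k + p ∉ box N), translation p (lp.single 2 k (torusChar (-k) z)) -
         ∑ k ∈ (box N).filter (fun k => k + -p ∉ box N), lp.single 2 k (torusChar (p - k) z)) := by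
      have e1 : translation p (planeWave z N) = (N : ℂ)⁻¹ •
          (∑ k ∈ (box N).filter (fun k => k + p ∈ box N),
            translation p (lp.single 2 k (torusChar (-k) z)) +
           ∑ k ∈ (box N).filter (fun k => k + p ∉ box N),
            translation p (lp.single 2 k (torusChar (-k) z))) := by
        rw [Finset.sum_filter_add_sum_filter_not, planeWave, map_smul, map_sum]
      have e2 : torusChar p z • planeWave z N = (N : ℂ)⁻¹ •
          (∑ k ∈ (box N).filter (fun k => k + -p ∈ box N), lp.single 2 k (torusChar (p - k) z) +
           ∑ k ∈ (box N).filter (fun k => k + -p ∉ box N), lp.single 2 k (torusChar (p - k) z)) := by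
        rw [Finset.sum_filter_add_sum_filter_not, planeWave, smul_comm, Finset.smul_sum]
        congr 1
        refine Finset.sum_congr rfl fun k _ => ?_
        rw [← lp.single_smul, sub_eq_add_neg, torusChar_add, smul_eq_mul]
      have e3 : ∑ k ∈ (box N).filter (fun k => k + p ∈ box N),
            translation p (lp.single 2 k (torusChar (-k) z)) =
          ∑ k ∈ (box N).filter (fun k => k + -p ∈ box N), lp.single 2 k (torusChar (p - k) z) := by
        refine Finset.sum_nbij' (fun k => k + p) (fun k => k + -p) ?_ ?_ ?_ ?_ ?_
        · intro k hk
          simp only [Finset.mem_filter] at hk ⊢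
          exact ⟨hk.2, by simpa using hk.1⟩
        · intro k hk
          simp only [Finset.mem_filter] at hk ⊢
          exact ⟨hk.2, by simpa using hk.1⟩
        · intro k _; simp
        · intro k _; simp
        · intro k _
          have hk : p - (k + p) = -k := by rw [add_comm k, sub_add_cancel_left]
          rw [translation_single, hk]
      rw [e1, e2, e3, ← smul_sub]
      congr 1
      abel
    have b1 : ‖∑ k ∈ (box N).filter (fun k => k + p ∉ box N),
        translation p (lp.single 2 k (torusChar (-k) z))‖ ≤ Real.sqrt (C * N) := by
      rw [← map_sum, norm_translation_apply]
      refine Real.le_sqrt_of_sq_le ?_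
      rw [norm_sum_single_sq _ (fun k => torusChar (-k) z) (fun k => norm_torusChar_apply _ _)]
      rw [hC]
      exact_mod_cast box_sdiff_card N p
    have b2 : ‖(∑ k ∈ (box N).filter (fun k => k + -p ∉ box N),
        lp.single 2 k (torusChar (p - k) z) : LatticeL2)‖ ≤ Real.sqrt (C * N) := by
      refine Real.le_sqrt_of_sq_le ?_
      rw [norm_sum_single_sq _ (fun k => torusChar (p - k) z) (fun k => norm_torusChar_apply _ _)]
      have := box_sdiff_card N (-p)
      simp only [Prod.fst_neg, Prod.snd_neg, Int.natAbs_neg] at this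
      rw [hC]
      exact_mod_cast this
    rw [hdiff, norm_smul, norm_inv, Complex.norm_natCast]
    gcongr
    refine (norm_sub_le _ _).trans ?_
    linarith
  have hlim : Tendsto (fun N : ℕ => (N : ℝ)⁻¹ * (2 * Real.sqrt (C * N))) atTop (𝓝 0) := by
    have h1 : Tendsto (fun N : ℕ => 2 * Real.sqrt C * (Real.sqrt (N : ℝ))⁻¹) atTop
        (𝓝 (2 * Real.sqrt C * 0)) :=
      ((Real.tendsto_sqrt_atTop.comp tendsto_natCast_atTop_atTop).inv_tendsto_atTop).const_mul _
    rw [mul_zero] at h1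
    refine h1.congr fun N => ?_
    rcases Nat.eq_zero_or_pos N with rfl | hN
    · simp
    · have hN' : (0 : ℝ) < N := by exact_mod_cast hN
      have hs : Real.sqrt (N : ℝ) ≠ 0 := (Real.sqrt_pos.mpr hN').ne'
      have hss : Real.sqrt (N : ℝ) * Real.sqrt (N : ℝ) = N := Real.mul_self_sqrt hN'.le
      rw [Real.sqrt_mul (by rw [hC]; positivity)]
      field_simp
      rw [sq, hss]
  exact squeeze_zero_norm hbound hlim

theorem symbol_norm_le {X : Set (ℤ × ℤ)} (h : ShiftsTo X Set.univ) :
    ∀ w ∈ StarAlgebra.adjoin ℂ (Set.range fun p => (compression X p, torusChar p)),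
      ‖w.2‖ ≤ ‖w.1‖ := by
  intro w hw
  rw [ContinuousMap.norm_le _ (norm_nonneg _)]
  intro z
  choose t ht using fun N => h (box N)
  have hmem : ∀ N, incl X (proj X (translation (t N) (planeWave z N))) =
      translation (t N) (planeWave z N) := fun N =>
    incl_proj_of_mem (planeWave_mem (fun k hk => (ht N k hk).mpr (Set.mem_univ k)) z)
  have hmain := norm_le_of_intertwine (compression X) torusChar
    ((Algebra.ofId ℂ (ℂ →L[ℂ] ℂ)).comp (ContinuousMap.evalAlgHom ℂ ℂ z))
    (fun p => ⟨-p, star_compression _ _, star_torusChar _⟩) atTop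
    (fun N : ℕ => ContinuousLinearMap.toSpanSingleton ℂ
      (proj X (translation (t N) (planeWave z N)))) (fun c => ?_) (fun p c => ?_) hw
  · have e : ((Algebra.ofId ℂ (ℂ →L[ℂ] ℂ)).comp (ContinuousMap.evalAlgHom ℂ ℂ z)) w.2 =
        algebraMap ℂ (ℂ →L[ℂ] ℂ) (w.2 z) := rfl
    rw [e, norm_algebraMap'] at hmain
    exact hmain
  · refine tendsto_const_nhds.congr' ?_
    filter_upwards [eventually_ne_atTop 0] with N hN
    rw [ContinuousLinearMap.toSpanSingleton_apply, norm_smul, ← norm_incl, hmem,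
      norm_translation_apply, norm_planeWave z N hN, mul_one]
  · have h1 := (tendsto_planeWave z p).norm
    rw [norm_zero] at h1
    have h2 := h1.const_mul ‖c‖
    rw [mul_zero] at h2
    refine squeeze_zero_norm (fun N => ?_) h2
    have e : compression X p (ContinuousLinearMap.toSpanSingleton ℂ
          (proj X (translation (t N) (planeWave z N))) c) -
        ContinuousLinearMap.toSpanSingleton ℂ (proj X (translation (t N) (planeWave z N)))
          (((Algebra.ofId ℂ (ℂ →L[ℂ] ℂ)).comp (ContinuousMap.evalAlgHom ℂ ℂ z)) (torusChar p) c) =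
        c • proj X (translation (t N)
          (translation p (planeWave z N) - torusChar p z • planeWave z N)) := by
      have e' : ((Algebra.ofId ℂ (ℂ →L[ℂ] ℂ)).comp (ContinuousMap.evalAlgHom ℂ ℂ z))
          (torusChar p) c = torusChar p z * c := rfl
      have e'' : compression X p (proj X (translation (t N) (planeWave z N))) =
          proj X (translation p (incl X (proj X (translation (t N) (planeWave z N))))) := rfl
      rw [e', ContinuousLinearMap.toSpanSingleton_apply, ContinuousLinearMap.toSpanSingleton_apply,
        map_smul, e'', hmem, translation_comm, map_sub, map_sub, map_smul, map_smul, smul_sub,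
        smul_smul, mul_comm c]
    rw [e, norm_smul]
    gcongr
    refine (norm_proj_le _ _).trans ?_
    rw [norm_translation_apply]

/-- The `*`-homomorphism from the Toeplitz algebra of `X` to the continuous functions on the torus
that sends the compression of the translation by `(m, n)` to the character `χ_{m,n}`. -/
def symbolHom {X : Set (ℤ × ℤ)} (h : ShiftsTo X Set.univ) : toeplitzAlgebra X →⋆ₐ[ℂ] C(Torus, ℂ) :=
  extendHom (symbol_norm_le h)

theorem symbolHom_gen {X : Set (ℤ × ℤ)} (h : ShiftsTo X Set.univ) (p : ℤ × ℤ) :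
    symbolHom h (toeplitzGen X p) = torusChar p :=
  extendHom_gen (symbol_norm_le h) (toeplitzGen X p) p rfl

theorem continuous_symbolHom {X : Set (ℤ × ℤ)} (h : ShiftsTo X Set.univ) :
    Continuous (symbolHom h) :=
  AddMonoidHomClass.continuous_of_bound (symbolHom h) 1
    (fun x => by rw [one_mul]; exact norm_extendHom_le (symbol_norm_le h) x)

/-! ### Lattice points near a line -/

theorem exists_near (u₁ u₂ v₁ v₂ : ℝ) (hdet : u₁ * v₂ - u₂ * v₁ ≠ 0) {ε : ℝ} (hε : 0 < ε) (M : ℝ) :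
    ∃ t : ℤ × ℤ, |u₁ * t.1 + u₂ * t.2| < ε ∧ v₁ * t.1 + v₂ * t.2 < -M := by
  suffices h : ∃ t : ℤ × ℤ, |u₁ * t.1 + u₂ * t.2| < ε ∧ M < |v₁ * t.1 + v₂ * t.2| by
    obtain ⟨t, h1, h2⟩ := h
    rcases lt_abs.mp h2 with h2 | h2
    · refine ⟨-t, ?_, ?_⟩
      · rw [← abs_neg]
        convert h1 using 2
        push_cast [Prod.fst_neg, Prod.snd_neg]
        ring
      · push_cast [Prod.fst_neg, Prod.snd_neg]
        linarith
    · exact ⟨t, h1, by linarith⟩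
  by_cases hu : u₁ = 0
  · subst hu
    have hv : v₁ ≠ 0 := by rintro rfl; simp at hdet
    obtain ⟨K, hK⟩ := exists_nat_gt (M / |v₁|)
    refine ⟨((K : ℤ), 0), by simpa using hε, ?_⟩
    rw [div_lt_iff₀ (abs_pos.mpr hv)] at hK
    simp only [Int.cast_natCast, Int.cast_zero, mul_zero, add_zero, abs_mul, Nat.abs_cast]
    linarith
  · set d := u₁ * v₂ - u₂ * v₁ with hd
    have hd0 : 0 < |d| := abs_pos.mpr hdet
    have hu0 : 0 < |u₁| := abs_pos.mpr hu
    obtain ⟨K, hK⟩ := exists_nat_gt ((|u₁| * |M| + |v₁| * ε) / |d|)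
    rw [div_lt_iff₀ hd0] at hK
    have hKpos : 0 < (K : ℝ) := by
      by_contra hneg
      have : (K : ℝ) * |d| ≤ 0 := mul_nonpos_of_nonpos_of_nonneg (not_lt.mp hneg) hd0.le
      have : 0 ≤ |u₁| * |M| + |v₁| * ε := by positivity
      linarith
    obtain ⟨n, hn⟩ := exists_nat_gt (|u₁| * K / ε)
    have hnpos : 0 < n := by
      have : (0 : ℝ) < n := lt_of_le_of_lt (by positivity) hn
      exact_mod_cast this
    obtain ⟨j, k, hk0, -, hjk⟩ := Real.exists_int_int_abs_mul_sub_le (u₂ / u₁) hnpos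
    have hk1 : (1 : ℝ) ≤ (k : ℝ) := by exact_mod_cast hk0
    have hU : u₁ * ((-(K * j) : ℤ) : ℝ) + u₂ * ((K * k : ℤ) : ℝ) =
        u₁ * K * ((k : ℝ) * (u₂ / u₁) - j) := by
      push_cast
      field_simp
      ring
    have hUlt : |u₁ * ((-(K * j) : ℤ) : ℝ) + u₂ * ((K * k : ℤ) : ℝ)| < ε := by
      rw [hU, abs_mul, abs_mul, Nat.abs_cast]
      rw [div_lt_iff₀ hε] at hn
      calc |u₁| * K * |(k : ℝ) * (u₂ / u₁) - j| ≤ |u₁| * K * (1 / (n + 1)) := by gcongr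
        _ < ε := by
          rw [mul_one_div, div_lt_iff₀ (by positivity)]
          nlinarith
    refine ⟨(-(K * j), K * k), hUlt, ?_⟩
    have hrel : u₁ * (v₁ * ((-(K * j) : ℤ) : ℝ) + v₂ * ((K * k : ℤ) : ℝ)) =
        v₁ * (u₁ * ((-(K * j) : ℤ) : ℝ) + u₂ * ((K * k : ℤ) : ℝ)) + d * (K * k) := by
      rw [hd]; push_cast; ring
    have hge : |d| * K - |v₁| * ε ≤ |u₁| * |v₁ * ((-(K * j) : ℤ) : ℝ) + v₂ * ((K * k : ℤ) : ℝ)| := by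
      rw [← abs_mul, hrel]
      have h1 := abs_sub_abs_le_abs_sub (d * ((K : ℝ) * k))
        (-(v₁ * (u₁ * ((-(K * j) : ℤ) : ℝ) + u₂ * ((K * k : ℤ) : ℝ))))
      rw [abs_neg, sub_neg_eq_add, add_comm (d * ((K : ℝ) * k))] at h1
      refine le_trans ?_ h1
      rw [abs_mul, abs_mul v₁, abs_mul (K : ℝ), Nat.abs_cast, abs_of_pos (by linarith : (0 : ℝ) < k)]
      have h2 : |d| * K ≤ |d| * (K * k) := by
        gcongr
        nlinarith
      have h3 := mul_le_mul_of_nonneg_left hUlt.le (abs_nonneg v₁)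
      linarith
    have : |u₁| * M < |u₁| * |v₁ * ((-(K * j) : ℤ) : ℝ) + v₂ * ((K * k : ℤ) : ℝ)| := by
      have := mul_le_mul_of_nonneg_left (le_abs_self M) hu0.le
      linarith
    exact lt_of_mul_lt_mul_left this hu0.le

theorem exists_near_pos (u₁ u₂ v₁ v₂ : ℝ) (hdet : u₁ * v₂ - u₂ * v₁ ≠ 0) {ε : ℝ} (hε : 0 < ε)
    {M : ℝ} (hM : 0 ≤ M) :
    ∃ t : ℤ × ℤ, 0 ≤ u₁ * t.1 + u₂ * t.2 ∧ u₁ * t.1 + u₂ * t.2 < ε ∧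
      v₁ * t.1 + v₂ * t.2 < -M := by
  obtain ⟨t, ht1, ht2⟩ := exists_near u₁ u₂ v₁ v₂ hdet hε M
  by_cases h0 : 0 ≤ u₁ * t.1 + u₂ * t.2
  · exact ⟨t, h0, (abs_lt.mp ht1).2, ht2⟩
  push Not at h0
  obtain ⟨s, hs1, hs2⟩ := exists_near u₁ u₂ v₁ v₂ hdet (neg_pos.mpr h0)
    (M - (v₁ * t.1 + v₂ * t.2))
  have hε' : -(u₁ * t.1 + u₂ * t.2) < ε := by linarith [(abs_lt.mp ht1).1]
  by_cases h1 : 0 ≤ u₁ * s.1 + u₂ * s.2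
  · exact ⟨s, h1, (abs_lt.mp hs1).2.trans hε', by linarith⟩
  push Not at h1
  set δ := -(u₁ * t.1 + u₂ * t.2) with hδ
  set η := -(u₁ * s.1 + u₂ * s.2) with hη
  have hη0 : 0 < η := by linarith
  have hηδ : η < δ := by linarith [(abs_lt.mp hs1).1]
  set k := ⌊δ / η⌋ with hk
  have hk1 : (1 : ℝ) ≤ k := by
    have : (1 : ℤ) ≤ k := Int.le_floor.mpr (by rw [Int.cast_one, one_le_div hη0]; exact hηδ.le)
    exact_mod_cast this
  have hk2 : (k : ℝ) * η ≤ δ := (le_div_iff₀ hη0).mp (Int.floor_le _)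
  have hk3 : δ < (k + 1) * η := (div_lt_iff₀ hη0).mp (Int.lt_floor_add_one _)
  have hu : u₁ * ((k * s.1 - t.1 : ℤ) : ℝ) + u₂ * ((k * s.2 - t.2 : ℤ) : ℝ) = δ - k * η := by
    rw [hδ, hη]; push_cast; ring
  refine ⟨(k * s.1 - t.1, k * s.2 - t.2), ?_, ?_, ?_⟩
  · rw [hu]; linarith
  · rw [hu]; linarith
  · have hv : v₁ * ((k * s.1 - t.1 : ℤ) : ℝ) + v₂ * ((k * s.2 - t.2 : ℤ) : ℝ) =
        k * (v₁ * s.1 + v₂ * s.2) - (v₁ * t.1 + v₂ * t.2) := by push_cast; ring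
    rw [hv]
    nlinarith

theorem exists_shift (u₁ u₂ v₁ v₂ : ℝ) (hdet : u₁ * v₂ - u₂ * v₁ ≠ 0) (S : Finset (ℤ × ℤ)) :
    ∃ t : ℤ × ℤ, ∀ p ∈ S,
      (0 ≤ u₁ * ((p + t).1 : ℝ) + u₂ * ((p + t).2 : ℝ) ↔ 0 ≤ u₁ * p.1 + u₂ * p.2) ∧
      v₁ * ((p + t).1 : ℝ) + v₂ * ((p + t).2 : ℝ) < 0 := by
  have h1 : ∃ ε : ℝ, 0 < ε ∧ ∀ p ∈ S, u₁ * p.1 + u₂ * p.2 < 0 → ε ≤ -(u₁ * p.1 + u₂ * p.2) := by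
    induction S using Finset.induction_on with
    | empty => exact ⟨1, one_pos, by simp⟩
    | insert a S _ ih =>
      obtain ⟨ε, hε, h⟩ := ih
      by_cases ha : u₁ * a.1 + u₂ * a.2 < 0
      · refine ⟨min ε (-(u₁ * a.1 + u₂ * a.2)), lt_min hε (by linarith), fun p hp hneg => ?_⟩
        rcases Finset.mem_insert.mp hp with rfl | hp
        · exact min_le_right _ _
        · exact (min_le_left _ _).trans (h p hp hneg)
      · refine ⟨ε, hε, fun p hp hneg => ?_⟩
        rcases Finset.mem_insert.mp hp with rfl | hp
        · exact absurd hneg ha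
        · exact h p hp hneg
  obtain ⟨ε, hε, hS⟩ := h1
  have h2 : ∀ p ∈ S, v₁ * p.1 + v₂ * p.2 ≤ ∑ q ∈ S, |v₁ * q.1 + v₂ * q.2| := fun p hp =>
    (le_abs_self _).trans
      (Finset.single_le_sum (f := fun q : ℤ × ℤ => |v₁ * q.1 + v₂ * q.2|)
        (fun _ _ => abs_nonneg _) hp)
  obtain ⟨t, ht1, ht2, ht3⟩ := exists_near_pos u₁ u₂ v₁ v₂ hdet hε
    (Finset.sum_nonneg fun q (_ : q ∈ S) => abs_nonneg (v₁ * q.1 + v₂ * q.2))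
  refine ⟨t, fun p hp => ⟨?_, ?_⟩⟩
  · have e : u₁ * ((p + t).1 : ℝ) + u₂ * ((p + t).2 : ℝ) =
        (u₁ * p.1 + u₂ * p.2) + (u₁ * t.1 + u₂ * t.2) := by
      push_cast [Prod.fst_add, Prod.snd_add]; ring
    rw [e]
    constructor
    · intro h
      by_contra hneg
      have := hS p hp (not_le.mp hneg)
      linarith
    · intro h; linarith
  · have e : v₁ * ((p + t).1 : ℝ) + v₂ * ((p + t).2 : ℝ) =
        (v₁ * p.1 + v₂ * p.2) + (v₁ * t.1 + v₂ * t.2) := by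
      push_cast [Prod.fst_add, Prod.snd_add]; ring
    rw [e]
    linarith [h2 p hp]

/-! ### Half-planes and the concave corner -/

/-- The lattice points of the half-plane `-α x + y ≥ 0`; for `α = -∞` it is `x ≥ 0`. -/
def halfPlaneAbove (α : EReal) : Set (ℤ × ℤ) :=
  {p | if α = ⊥ then 0 ≤ p.1 else 0 ≤ -α.toReal * (p.1 : ℝ) + (p.2 : ℝ)}

/-- The lattice points of the half-plane `-β x + y ≤ 0`; for `β = +∞` it is `x ≥ 0`. -/
def halfPlaneBelow (β : EReal) : Set (ℤ × ℤ) :=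
  {p | if β = ⊤ then 0 ≤ p.1 else -β.toReal * (p.1 : ℝ) + (p.2 : ℝ) ≤ 0}

/-- The concave corner: the union of the two half-planes. -/
def concaveCorner (α β : EReal) : Set (ℤ × ℤ) := halfPlaneAbove α ∪ halfPlaneBelow β

theorem mem_halfPlaneAbove (α : EReal) (p : ℤ × ℤ) : p ∈ halfPlaneAbove α ↔
    0 ≤ (if α = ⊥ then 1 else -α.toReal) * (p.1 : ℝ) + (if α = ⊥ then 0 else 1) * (p.2 : ℝ) := by
  by_cases h : α = ⊥ <;> simp [halfPlaneAbove, h]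

theorem mem_halfPlaneBelow (β : EReal) (p : ℤ × ℤ) : p ∈ halfPlaneBelow β ↔
    0 ≤ (if β = ⊤ then 1 else β.toReal) * (p.1 : ℝ) + (if β = ⊤ then 0 else -1) * (p.2 : ℝ) := by
  by_cases h : β = ⊤
  · simp [halfPlaneBelow, h]
  · simp only [halfPlaneBelow, h, if_false, Set.mem_ofPred_eq]
    constructor <;> intro h <;> linarith

theorem normals_independent {α β : EReal} (hαβ : α < β) (hne : ¬(α = ⊥ ∧ β = ⊤)) :
    (if α = ⊥ then 1 else -α.toReal) * (if β = ⊤ then 0 else -1) -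
      (if α = ⊥ then 0 else 1) * (if β = ⊤ then 1 else β.toReal) ≠ 0 := by
  by_cases ha : α = ⊥
  · have hb : β ≠ ⊤ := fun hb => hne ⟨ha, hb⟩
    simp [ha, hb]
  · by_cases hb : β = ⊤
    · simp [ha, hb]
    · lift α to ℝ using ⟨(hαβ.trans_le le_top).ne, ha⟩
      lift β to ℝ using ⟨hb, (bot_le.trans_lt hαβ).ne'⟩
      have h := EReal.coe_lt_coe_iff.mp hαβ
      simp only [ha, hb, if_false, EReal.toReal_coe]
      intro h'
      linarith

theorem shiftsTo_univ_of_normal {X : Set (ℤ × ℤ)} (u₁ u₂ : ℝ) (hu : u₁ ≠ 0 ∨ u₂ ≠ 0)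
    (hX : ∀ p : ℤ × ℤ, p ∈ X ↔ 0 ≤ u₁ * p.1 + u₂ * p.2) : ShiftsTo X Set.univ := by
  intro S
  have hdet : (-u₂) * (-u₂) - u₁ * (-u₁) ≠ 0 := by
    rcases hu with hu | hu
    · have := sq_pos_of_ne_zero hu
      nlinarith [sq_nonneg u₂]
    · have := sq_pos_of_ne_zero hu
      nlinarith [sq_nonneg u₁]
  obtain ⟨t, ht⟩ := exists_shift (-u₂) u₁ (-u₁) (-u₂) hdet S
  refine ⟨t, fun p hp => iff_of_true ?_ (Set.mem_univ p)⟩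
  rw [hX]
  linarith [(ht p hp).2]

theorem shiftsTo_above_univ (α : EReal) : ShiftsTo (halfPlaneAbove α) Set.univ :=
  shiftsTo_univ_of_normal _ _ (by by_cases h : α = ⊥ <;> simp [h]) (mem_halfPlaneAbove α)

theorem shiftsTo_below_univ (β : EReal) : ShiftsTo (halfPlaneBelow β) Set.univ :=
  shiftsTo_univ_of_normal _ _ (by by_cases h : β = ⊤ <;> simp [h]) (mem_halfPlaneBelow β)

theorem shiftsTo_corner_above {α β : EReal} (hαβ : α < β) (hne : ¬(α = ⊥ ∧ β = ⊤)) :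
    ShiftsTo (concaveCorner α β) (halfPlaneAbove α) := by
  intro S
  obtain ⟨t, ht⟩ := exists_shift _ _ _ _ (normals_independent hαβ hne) S
  refine ⟨t, fun p hp => ?_⟩
  rw [concaveCorner, Set.mem_union, mem_halfPlaneAbove, mem_halfPlaneBelow, mem_halfPlaneAbove,
    (ht p hp).1]
  exact or_iff_left (not_le.mpr (ht p hp).2)

theorem shiftsTo_corner_below {α β : EReal} (hαβ : α < β) (hne : ¬(α = ⊥ ∧ β = ⊤)) :
    ShiftsTo (concaveCorner α β) (halfPlaneBelow β) := by
  intro S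
  obtain ⟨t, ht⟩ := exists_shift (if β = ⊤ then 1 else β.toReal) (if β = ⊤ then 0 else -1)
    (if α = ⊥ then 1 else -α.toReal) (if α = ⊥ then 0 else 1)
    (fun h => normals_independent hαβ hne (by linarith)) S
  refine ⟨t, fun p hp => ?_⟩
  rw [concaveCorner, Set.mem_union, mem_halfPlaneAbove, mem_halfPlaneBelow, mem_halfPlaneBelow,
    (ht p hp).1]
  exact or_iff_right (not_le.mpr (ht p hp).2)

/-- The half-plane Toeplitz algebra `𝒯^α`. -/
abbrev ToeplitzAbove (α : EReal) := toeplitzAlgebra (halfPlaneAbove α)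

/-- The half-plane Toeplitz algebra `𝒯^β`. -/
abbrev ToeplitzBelow (β : EReal) := toeplitzAlgebra (halfPlaneBelow β)

/-- The concave corner Toeplitz algebra. -/
abbrev ConcaveToeplitz (α β : EReal) := toeplitzAlgebra (concaveCorner α β)

/-- The symbol map `σ^α : 𝒯^α → C(𝕋²)`, sending `P^α M_{m,n} P^α` to `χ_{m,n}`. -/
def sigmaAbove (α : EReal) : ToeplitzAbove α →⋆ₐ[ℂ] C(Torus, ℂ) :=
  symbolHom (shiftsTo_above_univ α)

/-- The symbol map `σ^β : 𝒯^β → C(𝕋²)`, sending `P^β M_{m,n} P^β` to `χ_{m,n}`. -/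
def sigmaBelow (β : EReal) : ToeplitzBelow β →⋆ₐ[ℂ] C(Torus, ℂ) :=
  symbolHom (shiftsTo_below_univ β)

/-- The pullback `𝒮^{α,β} = {(S, T) ∈ 𝒯^α ⊕ 𝒯^β | σ^α S = σ^β T}`. -/
def pullbackAlgebra (α β : EReal) : StarSubalgebra ℂ (ToeplitzAbove α × ToeplitzBelow β) :=
  StarAlgHom.equalizer ((sigmaAbove α).comp (StarAlgHom.fst ℂ (ToeplitzAbove α) (ToeplitzBelow β)))
    ((sigmaBelow β).comp (StarAlgHom.snd ℂ (ToeplitzAbove α) (ToeplitzBelow β)))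

/-- The half-plane symbol from the concave corner Toeplitz algebra to `𝒯^α`, sending the
compression of each translation to the corner to its compression to the half-plane. -/
def gammaAbove {α β : EReal} (hαβ : α < β) (hne : ¬(α = ⊥ ∧ β = ⊤)) :
    ConcaveToeplitz α β →⋆ₐ[ℂ] ToeplitzAbove α :=
  restrictHom (shiftsTo_corner_above hαβ hne)

/-- The half-plane symbol from the concave corner Toeplitz algebra to `𝒯^β`, sending the
compression of each translation to the corner to its compression to the half-plane. -/
def gammaBelow {α β : EReal} (hαβ : α < β) (hne : ¬(α = ⊥ ∧ β = ⊤)) :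
    ConcaveToeplitz α β →⋆ₐ[ℂ] ToeplitzBelow β :=
  restrictHom (shiftsTo_corner_below hαβ hne)

theorem gammaAbove_gen {α β : EReal} (hαβ : α < β) (hne : ¬(α = ⊥ ∧ β = ⊤)) (p : ℤ × ℤ) :
    gammaAbove hαβ hne (toeplitzGen _ p) = toeplitzGen _ p :=
  restrictHom_gen _ p

theorem gammaBelow_gen {α β : EReal} (hαβ : α < β) (hne : ¬(α = ⊥ ∧ β = ⊤)) (p : ℤ × ℤ) :
    gammaBelow hαβ hne (toeplitzGen _ p) = toeplitzGen _ p :=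
  restrictHom_gen _ p

theorem sigma_comp_gamma {α β : EReal} (hαβ : α < β) (hne : ¬(α = ⊥ ∧ β = ⊤)) :
    (sigmaAbove α).comp (gammaAbove hαβ hne) = (sigmaBelow β).comp (gammaBelow hαβ hne) := by
  refine toeplitz_hom_ext
    ((continuous_symbolHom (shiftsTo_above_univ α)).comp
      (continuous_restrictHom (shiftsTo_corner_above hαβ hne)))
    ((continuous_symbolHom (shiftsTo_below_univ β)).comp
      (continuous_restrictHom (shiftsTo_corner_below hαβ hne))) fun p => ?_
  rw [StarAlgHom.comp_apply, StarAlgHom.comp_apply, gammaAbove_gen, gammaBelow_gen, sigmaAbove,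
    sigmaBelow, symbolHom_gen, symbolHom_gen]

/-- The symbol map from the concave corner Toeplitz algebra to `𝒮^{α,β}`, with the two half-plane
symbols as its components. -/
def gamma {α β : EReal} (hαβ : α < β) (hne : ¬(α = ⊥ ∧ β = ⊤)) :
    ConcaveToeplitz α β →⋆ₐ[ℂ] pullbackAlgebra α β :=
  StarAlgHom.codRestrict ((gammaAbove hαβ hne).prod (gammaBelow hαβ hne)) (pullbackAlgebra α β)
    (fun T => DFunLike.congr_fun (sigma_comp_gamma hαβ hne) T)

end ConcaveCorner

end

noncomputable section

namespace ConcaveCorner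

/-! ### Compressions and lattice points -/

/-! A word in compressions carries a basis vector `e_k` through finitely many lattice points near
`k` and kills it when one of them leaves the region. Its effect on `e_k` therefore depends only on
the shape of the region near `k`. This locality (`eventually_intertwine`) drives both directions.

Fredholm implies invertible symbols. Translate along one edge of the corner, away from the other
half-plane: every finite set of points eventually sees only one half-plane. In the limit these
translations are isometric and intertwine `T` with its half-plane symbol
(`tendsto_norm_proj_translation`, `tendsto_intertwine`). A quasi-inverse of `T` has finite-range
errors, and these vanish on vectors that run off to infinity. Hence the symbol inherits a lower
bound from `T`, and its adjoint inherits one from the adjoint of `T` (`norm_le_of_leftInverse_mod`).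
So the symbol is invertible as an operator, and by spectral permanence also in the closed half-plane
algebra.

Invertible symbols imply Fredholm. Cut the corner into two pieces. On each piece the corner
coincides, away from finitely many points, with one half-plane at any prescribed scale. An element
killed by both symbols is therefore a norm limit of finite-range operators
(`mem_approxFiniteRange_of_gamma_eq_zero`). The inverse symbols are not lifted, so surjectivity of
`gamma` plays no role. Instead, functional calculus adds to `star T * T` an element of both kernels
that makes it invertible, and likewise for `T * star T` (`exists_isUnit_star_mul_self_add`). Thus
`T` is invertible from both sides modulo limits of finite-range operators. Since units form an open
set, finite-range errors suffice (`isFredholm_of_left_of_right`).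

In the pullback, inverses of elements with equal image in `C(Torus, ℂ)` again have equal image
there, so componentwise inverses stay inside. -/

theorem compression_proj_basisVec_of_mem {X : Set (ℤ × ℤ)} {k : ℤ × ℤ} (p : ℤ × ℤ) (hk : k ∈ X) :
    compression X p (proj X (basisVec k)) = proj X (basisVec (k + p)) := by
  change proj X (translation p (incl X (proj X (basisVec k)))) = _
  rw [incl_proj_of_mem (basisVec_mem hk), translation_basisVec]

/-- The generating pairs are permuted by the adjoint, so linear combinations of words exhaust the
`*`-algebra. Letters are peeled off on the right because the rightmost letter is the one that acts
first on a basis vector. -/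
theorem adjoin_compression_induction_right {X A : Set (ℤ × ℤ)}
    {C : (RegionSpace X →L[ℂ] RegionSpace X) × (RegionSpace A →L[ℂ] RegionSpace A) → Prop}
    (one : C 1) (add : ∀ z w, C z → C w → C (z + w)) (smul : ∀ (c : ℂ) z, C z → C (c • z))
    (mul : ∀ z p, C z → C (z * (compression X p, compression A p)))
    {z : (RegionSpace X →L[ℂ] RegionSpace X) × (RegionSpace A →L[ℂ] RegionSpace A)}
    (hz : z ∈ StarAlgebra.adjoin ℂ (Set.range fun p => (compression X p, compression A p))) :
    C z := by
  have hz' : z ∈ Algebra.adjoin ℂ (Set.range fun p => (compression X p, compression A p)) := by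
    have : z ∈ Algebra.adjoin ℂ ((Set.range fun p => (compression X p, compression A p)) ∪
      star (Set.range fun p => (compression X p, compression A p))) := hz
    rwa [Set.union_eq_self_of_subset_right] at this
    rintro w ⟨p, hp⟩
    refine ⟨-p, ?_⟩
    rw [← star_star w, ← hp]
    simp [Prod.star_def, star_compression]
  clear hz
  rw [← Subalgebra.mem_toSubmodule, Algebra.adjoin_eq_span] at hz'
  induction hz' using Submodule.span_induction with
  | mem x hx =>
    induction hx using Submonoid.closure_induction_right with
    | one => exact one
    | mul_right x _ y hy ih => obtain ⟨p, rfl⟩ := hy; exact mul x p ih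
  | zero => simpa using smul 0 1 one
  | add x y _ _ hx hy => exact add x y hx hy
  | smul c x _ hx => exact smul c x hx

/-- If the translates of the points `x i` by `t i` eventually lie in `X` exactly when the `x i` lie
in `A`, and likewise for all fixed shifts of `x`, then corresponding `*`-polynomials in the
compressions to `X` and `A` eventually agree at these points. -/
theorem eventually_intertwine {X A : Set (ℤ × ℤ)} {ι : Type*} {l : Filter ι} (t : ι → ℤ × ℤ)
    {z : (RegionSpace X →L[ℂ] RegionSpace X) × (RegionSpace A →L[ℂ] RegionSpace A)}
    (hz : z ∈ StarAlgebra.adjoin ℂ (Set.range fun p => (compression X p, compression A p)))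
    (x : ι → ℤ × ℤ) (hx : ∀ p, ∀ᶠ i in l, (x i + p + t i ∈ X ↔ x i + p ∈ A)) :
    ∀ᶠ i in l, z.1 (proj X (basisVec (x i + t i))) =
      proj X (translation (t i) (incl A (z.2 (proj A (basisVec (x i)))))) := by
  revert x
  refine adjoin_compression_induction_right (C := fun z => ∀ x : ι → ℤ × ℤ,
    (∀ p, ∀ᶠ i in l, (x i + p + t i ∈ X ↔ x i + p ∈ A)) →
    ∀ᶠ i in l, z.1 (proj X (basisVec (x i + t i))) =
      proj X (translation (t i) (incl A (z.2 (proj A (basisVec (x i))))))) ?_ ?_ ?_ ?_ hz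
  · intro x hx
    filter_upwards [hx 0] with i hi
    rw [add_zero] at hi
    simp only [Prod.fst_one, Prod.snd_one, one_apply_eq_self]
    by_cases h : x i ∈ A
    · rw [incl_proj_of_mem (basisVec_mem h), translation_basisVec]
    · rw [proj_basisVec_of_notMem h, proj_basisVec_of_notMem (fun h' => h (hi.mp h'))]
      simp
  · intro z w hz hw x hx
    filter_upwards [hz x hx, hw x hx] with i h1 h2
    simp [h1, h2]
  · intro c z hz x hx
    filter_upwards [hz x hx] with i h1
    simp [h1]
  -- The letter `p` moves `x i` to `x i + p`, so the inductive hypothesis is needed for the shifted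
  -- family; hence the quantification over all `x`. When `x i` lies outside `A`, both sides vanish.
  · intro z p hz x hx
    have h := hz (fun i => x i + p) (fun q => by simpa only [add_assoc] using hx (p + q))
    filter_upwards [hx 0, h] with i hi h
    rw [add_zero] at hi
    simp only [Prod.fst_mul, Prod.snd_mul, mul_apply_eq_comp]
    by_cases hA : x i ∈ A
    · rw [compression_proj_basisVec_of_mem p hA, compression_proj_basisVec_of_mem p (hi.mpr hA),
        ← h, add_right_comm]
    · rw [proj_basisVec_of_notMem hA, proj_basisVec_of_notMem (fun h' => hA (hi.mp h'))]
      simp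

/-! ### Operators of finite range and their limits -/

/-- The norm closure of the operators of finite range. -/
def approxFiniteRange (E F : Type*) [NormedAddCommGroup E] [NormedSpace ℂ E]
    [NormedAddCommGroup F] [NormedSpace ℂ F] : Submodule ℂ (E →L[ℂ] F) :=
  ((LinearMap.finiteRange ℂ E F).comap (ContinuousLinearMap.coeLM ℂ)).topologicalClosure

section ApproxFiniteRange

variable {E F G : Type*} [NormedAddCommGroup E] [NormedSpace ℂ E]
    [NormedAddCommGroup F] [NormedSpace ℂ F] [NormedAddCommGroup G] [NormedSpace ℂ G]

theorem mem_approxFiniteRange_of_hasFiniteRange {f : E →L[ℂ] F}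
    (hf : (f : E →ₗ[ℂ] F).HasFiniteRange) : f ∈ approxFiniteRange E F :=
  Submodule.le_topologicalClosure _ hf.hasNoetherianRange

theorem exists_hasFiniteRange_norm_sub_lt {f : E →L[ℂ] F} (hf : f ∈ approxFiniteRange E F)
    {ε : ℝ} (hε : 0 < ε) :
    ∃ g : E →L[ℂ] F, (g : E →ₗ[ℂ] F).HasFiniteRange ∧ ‖f - g‖ < ε := by
  obtain ⟨g, hg, h⟩ := Metric.mem_closure_iff.mp hf ε hε
  exact ⟨g, LinearMap.HasNoetherianRange.hasFiniteRange hg, by rwa [← dist_eq_norm]⟩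

theorem isClosed_approxFiniteRange : IsClosed (approxFiniteRange E F : Set (E →L[ℂ] F)) :=
  Submodule.isClosed_topologicalClosure _

theorem approxFiniteRange_comp {f : F →L[ℂ] G} (hf : f ∈ approxFiniteRange F G) (g : E →L[ℂ] F) :
    f ∘L g ∈ approxFiniteRange E G := by
  have hcl : IsClosed {f : F →L[ℂ] G | f ∘L g ∈ approxFiniteRange E G} :=
    isClosed_approxFiniteRange.preimage (by fun_prop)
  refine closure_minimal (fun f hf => ?_) hcl hf
  exact mem_approxFiniteRange_of_hasFiniteRange
    ((LinearMap.HasNoetherianRange.hasFiniteRange hf).comp_right (g : E →ₗ[ℂ] F))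

end ApproxFiniteRange

/-- By continuity `M f` is the sum of the vectors `f k • M (basisVec k)`, and only finitely many of
them can be nonzero. -/
theorem hasFiniteRange_of_eventually_eq_zero {F : Type*} [NormedAddCommGroup F] [NormedSpace ℂ F]
    (M : LatticeL2 →L[ℂ] F) (h : ∀ᶠ k in cofinite, M (basisVec k) = 0) :
    (M : LatticeL2 →ₗ[ℂ] F).HasFiniteRange := by
  have hfin : {k | M (basisVec k) ≠ 0}.Finite := h
  set S := hfin.toFinset with hS
  have hle : (M : LatticeL2 →ₗ[ℂ] F).range ≤
      Submodule.span ℂ ((fun k => M (basisVec k)) '' S) := by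
    rintro _ ⟨f, rfl⟩
    have h1 := (lp.hasSum_single (E := fun _ : ℤ × ℤ => ℂ) (p := 2) (by norm_num) f).mapL M
    have h2 : ∀ k, M (lp.single 2 k (f k)) = f k • M (basisVec k) := by
      intro k
      rw [← map_smul, basisVec, ← lp.single_smul]
      simp
    simp only [h2] at h1
    have h3 := hasSum_sum_of_ne_finset_zero (L := .unconditional _) (f := fun k => f k • M (basisVec k)) (s := S)
      (fun k hk => by
        have : M (basisVec k) = 0 := by simpa [hS] using hk
        simp [this])
    change M f ∈ _
    rw [h1.unique h3]
    exact Submodule.sum_mem _ fun k hk =>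
      Submodule.smul_mem _ _ (Submodule.subset_span ⟨k, hk, rfl⟩)
  rw [LinearMap.hasFiniteRange_iff_range]
  have hfd : FiniteDimensional ℂ (Submodule.span ℂ ((fun k => M (basisVec k)) '' S)) :=
    FiniteDimensional.span_of_finite ℂ (S.finite_toSet.image _)
  have := Submodule.finiteDimensional_of_le hle
  exact (Submodule.fg_iff_finiteDimensional _).mpr this

/-- Corresponding elements of the Toeplitz algebras of `X` and `A` differ on `D` by a limit of
operators of finite range, provided that `X` and `A` agree near all but finitely many points
of `D`. -/
theorem genGraph_sub_mem_approxFiniteRange {X A D : Set (ℤ × ℤ)}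
    (hD : ∀ p, {k ∈ D | ¬(k + p ∈ X ↔ k + p ∈ A)}.Finite)
    {z : (RegionSpace X →L[ℂ] RegionSpace X) × (RegionSpace A →L[ℂ] RegionSpace A)}
    (hz : z ∈ genGraph (compression X) (compression A)) :
    z.1 ∘L proj X ∘L incl D ∘L proj D - proj X ∘L incl A ∘L z.2 ∘L proj A ∘L incl D ∘L proj D ∈
      approxFiniteRange LatticeL2 (RegionSpace X) := by
  have hcl : IsClosed {z : (RegionSpace X →L[ℂ] RegionSpace X) ×
      (RegionSpace A →L[ℂ] RegionSpace A) | z.1 ∘L proj X ∘L incl D ∘L proj D -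
      proj X ∘L incl A ∘L z.2 ∘L proj A ∘L incl D ∘L proj D ∈
      approxFiniteRange LatticeL2 (RegionSpace X)} :=
    isClosed_approxFiniteRange.preimage (by fun_prop)
  refine closure_minimal (fun z hz => ?_) hcl hz
  refine mem_approxFiniteRange_of_hasFiniteRange (hasFiniteRange_of_eventually_eq_zero _ ?_)
  -- No translation is needed here: the point itself runs to infinity inside `D`. The finite
  -- exceptional set depends on the polynomial, so finite range holds only before passing to the
  -- closure.
  have h := eventually_intertwine (l := cofinite ⊓ 𝓟 D) (fun _ => 0) hz id (fun p => by
    rw [eventually_inf_principal]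
    refine (hD p).subset fun k hk => ?_
    simpa using hk)
  rw [eventually_inf_principal] at h
  filter_upwards [h] with k hk
  by_cases hkD : k ∈ D
  · have h0 : ∀ f : LatticeL2, translation 0 f = f := fun f => by
      ext k; simp [translation_apply]
    have := hk hkD
    simp only [id, add_zero, h0] at this
    simp only [sub_apply, ContinuousLinearMap.comp_apply, incl_proj_of_mem (basisVec_mem hkD), this,
      sub_self]
  · simp [proj_basisVec_of_notMem hkD]

theorem incl_proj_add_incl_proj {X D D' : Set (ℤ × ℤ)} (hX : D ∪ D' = X) (hD : Disjoint D D')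
    {f : LatticeL2} (hf : f ∈ regionSubmodule X) :
    incl D (proj D f) + incl D' (proj D' f) = f := by
  have hcl : IsClosed {f : LatticeL2 | incl D (proj D f) + incl D' (proj D' f) = f} :=
    isClosed_eq (by fun_prop) continuous_id
  refine closure_minimal (fun f (hf : f ∈ Submodule.span ℂ (basisVec '' X)) => ?_) hcl hf
  change incl D (proj D f) + incl D' (proj D' f) = f
  clear * - hf hX hD
  induction hf using Submodule.span_induction with
  | mem x hx =>
    obtain ⟨k, hk, rfl⟩ := hx
    rw [← hX] at hk
    rcases hk with hk | hk
    · rw [incl_proj_of_mem (basisVec_mem hk), proj_basisVec_of_notMem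
        (Set.disjoint_left.mp hD hk), map_zero, add_zero]
    · rw [incl_proj_of_mem (basisVec_mem hk), proj_basisVec_of_notMem
        (Set.disjoint_right.mp hD hk), map_zero, zero_add]
  | zero => simp
  | add x y _ _ hx hy => rw [map_add, map_add, map_add, map_add, add_add_add_comm, hx, hy]
  | smul c x _ hx => rw [map_smul, map_smul, map_smul, map_smul, ← smul_add, hx]

/-- With symbol zero, the previous comparison says that `T` restricted to each of the two pieces is
a limit of finite-range operators; the two restrictions add up to `T`. -/
theorem mem_approxFiniteRange_of_genGraph_zero {X A B D D' : Set (ℤ × ℤ)} (hX : D ∪ D' = X)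
    (hDD' : Disjoint D D') (hD : ∀ p, {k ∈ D | ¬(k + p ∈ X ↔ k + p ∈ A)}.Finite)
    (hD' : ∀ p, {k ∈ D' | ¬(k + p ∈ X ↔ k + p ∈ B)}.Finite)
    {T : RegionSpace X →L[ℂ] RegionSpace X}
    (hA : (T, 0) ∈ genGraph (compression X) (compression A))
    (hB : (T, 0) ∈ genGraph (compression X) (compression B)) :
    T ∈ approxFiniteRange (RegionSpace X) (RegionSpace X) := by
  have h := approxFiniteRange_comp (add_mem (genGraph_sub_mem_approxFiniteRange hD hA)
    (genGraph_sub_mem_approxFiniteRange hD' hB)) (incl X)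
  convert h using 1
  ext1 f
  have h2 := incl_proj_add_incl_proj hX hDD' f.2
  simp only [add_apply, sub_apply, ContinuousLinearMap.comp_apply, zero_apply, map_zero, sub_zero,
    ← map_add]
  change T f = T (proj X (incl D (proj D f.1) + incl D' (proj D' f.1)))
  rw [h2]
  congr 1
  exact (Submodule.orthogonalProjectionOnto_mem_subspace_eq_self (K := regionSubmodule X) f).symm

/-! ### Lattice points of the corner near its edges -/

theorem finite_abs_le_abs_le (u₁ u₂ v₁ v₂ : ℝ) (hdet : u₁ * v₂ - u₂ * v₁ ≠ 0) (c : ℝ) :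
    {k : ℤ × ℤ | |u₁ * k.1 + u₂ * k.2| ≤ c ∧ |v₁ * k.1 + v₂ * k.2| ≤ c}.Finite := by
  have hd : 0 < |u₁ * v₂ - u₂ * v₁| := abs_pos.mpr hdet
  obtain ⟨N, hN⟩ := exists_nat_gt
    ((|u₁| + |u₂| + |v₁| + |v₂|) * c / |u₁ * v₂ - u₂ * v₁|)
  rw [div_lt_iff₀ hd] at hN
  refine ((Set.finite_Icc (-(N : ℤ)) N).prod (Set.finite_Icc (-(N : ℤ)) N)).subset ?_
  rintro ⟨a, b⟩ ⟨h1, h2⟩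
  simp only at h1 h2
  have hc : 0 ≤ c := (abs_nonneg _).trans h1
  have key : ∀ (m : ℤ) (x y U V : ℝ), |U| ≤ c → |V| ≤ c →
      (u₁ * v₂ - u₂ * v₁) * m = x * U + y * V →
      |x| + |y| ≤ |u₁| + |u₂| + |v₁| + |v₂| → m ∈ Set.Icc (-(N : ℤ)) N := by
    intro m x y U V hU hV hm hxy
    have h3 : |u₁ * v₂ - u₂ * v₁| * |(m : ℝ)| ≤ (|u₁| + |u₂| + |v₁| + |v₂|) * c := by
      rw [← abs_mul, hm]
      calc |x * U + y * V| ≤ |x| * |U| + |y| * |V| := by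
            rw [← abs_mul, ← abs_mul]; exact abs_add_le _ _
        _ ≤ |x| * c + |y| * c := by gcongr
        _ = (|x| + |y|) * c := by ring
        _ ≤ _ := by gcongr
    have h4 : |(m : ℝ)| < N := by
      refine lt_of_mul_lt_mul_left ?_ hd.le
      linarith
    have h5 : |m| < N := by exact_mod_cast h4
    exact ⟨(abs_lt.mp h5).1.le, (abs_lt.mp h5).2.le⟩
  -- Cramer's rule: each coordinate times the determinant is a combination of the two bounded linear
  -- forms.
  refine ⟨key a v₂ (-u₂) _ _ h1 h2 (by ring) ?_, key b (-v₁) u₁ _ _ h1 h2 (by ring) ?_⟩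
  · rw [abs_neg]; linarith [abs_nonneg u₁, abs_nonneg v₁]
  · rw [abs_neg]; linarith [abs_nonneg u₂, abs_nonneg v₂]

/-- Let `u` and `v` be the two linear forms. On `D` the form `u` is nonnegative and dominates `v`.
If `k + p` lies in `B` but not in `A`, then `u k < -u p` and `v k ≥ -v p`. Both independent forms
are thus bounded at `k`, which leaves finitely many lattice points. -/
theorem finite_not_mem_union_iff {A B D : Set (ℤ × ℤ)} (u₁ u₂ v₁ v₂ : ℝ)
    (hdet : u₁ * v₂ - u₂ * v₁ ≠ 0) (hA : ∀ k : ℤ × ℤ, k ∈ A ↔ 0 ≤ u₁ * k.1 + u₂ * k.2)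
    (hB : ∀ k : ℤ × ℤ, k ∈ B ↔ 0 ≤ v₁ * k.1 + v₂ * k.2)
    (hD : ∀ k ∈ D, k ∈ A ∪ B ∧ v₁ * k.1 + v₂ * k.2 ≤ u₁ * k.1 + u₂ * k.2) (p : ℤ × ℤ) :
    {k ∈ D | ¬(k + p ∈ A ∪ B ↔ k + p ∈ A)}.Finite := by
  set c := |u₁ * p.1 + u₂ * p.2| + |v₁ * p.1 + v₂ * p.2| with hc
  refine (finite_abs_le_abs_le u₁ u₂ v₁ v₂ hdet c).subset ?_
  rintro k ⟨hk, hkp⟩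
  obtain ⟨hkX, hvu⟩ := hD k hk
  have hkB : k + p ∈ B ∧ k + p ∉ A := by
    rw [Set.mem_union] at hkp
    tauto
  rw [hA, hB] at hkB
  push_cast [Prod.fst_add, Prod.snd_add] at hkB
  have hu0 : 0 ≤ u₁ * k.1 + u₂ * k.2 := by
    rcases hkX with h | h
    · exact (hA k).mp h
    · exact ((hB k).mp h).trans hvu
  have h1 := neg_abs_le (u₁ * p.1 + u₂ * p.2)
  have h2 := le_abs_self (v₁ * p.1 + v₂ * p.2)
  have h3 := abs_nonneg (u₁ * p.1 + u₂ * p.2)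
  have h4 := abs_nonneg (v₁ * p.1 + v₂ * p.2)
  have h5 := not_le.mp hkB.2
  exact ⟨abs_le.mpr ⟨by linarith, by linarith⟩, abs_le.mpr ⟨by linarith [hkB.1], by linarith⟩⟩

/-! ### Lower bounds for the half-plane symbols of Fredholm operators -/

section Shift

variable {κ : Type*} {l : Filter κ} {X A : Set (ℤ × ℤ)} {t : κ → ℤ × ℤ}

theorem norm_proj_translation_incl_le (i : κ) (f : RegionSpace A) :
    ‖proj X (translation (t i) (incl A f))‖ ≤ ‖f‖ := by
  refine (norm_proj_le _ _).trans ?_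
  rw [norm_translation_apply, norm_incl]

/-- A basis vector of the half-space is eventually translated into the subspace of `X`, where the
projection does nothing; a uniform bound extends this to all vectors by density. -/
theorem tendsto_norm_proj_translation (ht : ∀ p, ∀ᶠ i in l, (p + t i ∈ X ↔ p ∈ A))
    (f : RegionSpace A) :
    Tendsto (fun i => ‖proj X (translation (t i) (incl A f))‖) l (𝓝 ‖f‖) := by
  have h1 : Tendsto (fun i => incl X (proj X (translation (t i) (incl A f))) -
      translation (t i) (incl A f)) l (𝓝 0) := by
    refine tendsto_zero_of_dense (C := 2) (X := A)
      (fun i => (incl X ∘L proj X ∘L translation (t i)) - translation (t i))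
      (fun i g => ?_) (fun q hq => ?_) f.2
    · change ‖incl X (proj X (translation (t i) g)) - translation (t i) g‖ ≤ _
      refine (norm_sub_le _ _).trans ?_
      have := norm_proj_le X (translation (t i) g)
      rw [norm_translation_apply] at this ⊢
      rw [norm_incl]
      linarith
    · refine tendsto_const_nhds.congr' ?_
      filter_upwards [ht q] with i hi
      simp only [sub_apply, ContinuousLinearMap.comp_apply, translation_basisVec]
      rw [incl_proj_of_mem (basisVec_mem (hi.mpr hq)), sub_self]
  have h2 := h1.norm
  rw [norm_zero] at h2
  rw [tendsto_iff_norm_sub_tendsto_zero]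
  refine squeeze_zero (fun _ => norm_nonneg _) (fun i => ?_) h2
  have h3 := abs_norm_sub_norm_le (incl X (proj X (translation (t i) (incl A f))))
    (translation (t i) (incl A f))
  rwa [norm_translation_apply, norm_incl, norm_incl] at h3

/-- For a polynomial the intertwining is eventually exact on each basis vector, and the error
operators are bounded by `‖z.1‖ + ‖z.2‖`, so density gives convergence. -/
theorem tendsto_intertwine_of_mem_adjoin (ht : ∀ p, ∀ᶠ i in l, (p + t i ∈ X ↔ p ∈ A))
    {z : (RegionSpace X →L[ℂ] RegionSpace X) × (RegionSpace A →L[ℂ] RegionSpace A)}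
    (hz : z ∈ StarAlgebra.adjoin ℂ (Set.range fun p => (compression X p, compression A p)))
    (f : RegionSpace A) :
    Tendsto (fun i => z.1 (proj X (translation (t i) (incl A f))) -
      proj X (translation (t i) (incl A (z.2 f)))) l (𝓝 0) := by
  have h2 : Tendsto (fun i => incl X (z.1 (proj X (translation (t i) (incl A f)))) -
      incl X (proj X (translation (t i) (incl A (z.2 (proj A (incl A f))))))) l (𝓝 0) := by
    refine tendsto_zero_of_dense (C := ‖z.1‖ + ‖z.2‖) (X := A)
      (fun i => (incl X ∘L z.1 ∘L proj X ∘L translation (t i)) -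
        (incl X ∘L proj X ∘L translation (t i) ∘L incl A ∘L z.2 ∘L proj A))
      (fun i g => ?_) (fun q hq => ?_) f.2
    · change ‖incl X (z.1 (proj X (translation (t i) g))) -
        incl X (proj X (translation (t i) (incl A (z.2 (proj A g)))))‖ ≤ _
      refine (norm_sub_le _ _).trans ?_
      rw [norm_incl, norm_incl, add_mul]
      gcongr
      · refine z.1.le_opNorm_of_le ((norm_proj_le _ _).trans ?_)
        rw [norm_translation_apply]
      · exact (norm_proj_translation_incl_le _ _).trans (z.2.le_opNorm_of_le (norm_proj_le _ _))
    · refine tendsto_const_nhds.congr' ?_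
      filter_upwards [eventually_intertwine t hz (fun _ => q) (fun p => ht (q + p))] with i hi
      simp only [sub_apply, ContinuousLinearMap.comp_apply, translation_basisVec]
      rw [hi, sub_self]
  have hf : proj A (incl A f) = f :=
    Submodule.orthogonalProjectionOnto_mem_subspace_eq_self (K := regionSubmodule A) f
  rw [hf] at h2
  rw [tendsto_zero_iff_norm_tendsto_zero] at h2 ⊢
  refine h2.congr fun i => ?_
  rw [← map_sub, norm_incl]

theorem tendsto_intertwine (ht : ∀ p, ∀ᶠ i in l, (p + t i ∈ X ↔ p ∈ A))
    {z : (RegionSpace X →L[ℂ] RegionSpace X) × (RegionSpace A →L[ℂ] RegionSpace A)}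
    (hz : z ∈ genGraph (compression X) (compression A)) (f : RegionSpace A) :
    Tendsto (fun i => z.1 (proj X (translation (t i) (incl A f))) -
      proj X (translation (t i) (incl A (z.2 f)))) l (𝓝 0) := by
  rw [Metric.tendsto_nhds]
  intro ε hε
  -- Replacing `z` by the polynomial `w` costs at most `ε / 4` in each component; the other `ε / 2`
  -- is spent on the intertwining error of `w`. The summand `1` covers `f = 0`.
  obtain ⟨w, hw, hzw⟩ := Metric.mem_closure_iff.mp hz (ε / (4 * (‖f‖ + 1))) (by positivity)
  filter_upwards [Metric.tendsto_nhds.mp (tendsto_intertwine_of_mem_adjoin ht hw f) (ε / 2)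
    (by positivity)] with i hi
  rw [dist_zero_right] at hi ⊢
  rw [dist_eq_norm, Prod.norm_def, max_lt_iff] at hzw
  have hb : ε / (4 * (‖f‖ + 1)) * ‖f‖ ≤ ε / 4 := by
    rw [div_mul_eq_mul_div, div_le_div_iff₀ (by positivity) (by positivity)]
    nlinarith [norm_nonneg f]
  have h1 : ‖(z - w).1 (proj X (translation (t i) (incl A f)))‖ ≤ ε / 4 :=
    (((z - w).1.le_opNorm_of_le (norm_proj_translation_incl_le i f)).trans
      (by gcongr; exact hzw.1.le)).trans hb
  have h2 : ‖proj X (translation (t i) (incl A ((z - w).2 f)))‖ ≤ ε / 4 :=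
    (norm_proj_translation_incl_le i _).trans
      ((((z - w).2.le_opNorm f).trans (by gcongr; exact hzw.2.le)).trans hb)
  have e : z.1 (proj X (translation (t i) (incl A f))) -
      proj X (translation (t i) (incl A (z.2 f))) =
      (w.1 (proj X (translation (t i) (incl A f))) -
        proj X (translation (t i) (incl A (w.2 f)))) +
      ((z - w).1 (proj X (translation (t i) (incl A f))) -
        proj X (translation (t i) (incl A ((z - w).2 f)))) := by
    simp only [Prod.fst_sub, Prod.snd_sub, sub_apply, map_sub]
    abel
  rw [e]
  refine (norm_add_le _ _).trans_lt ?_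
  linarith [norm_sub_le ((z - w).1 (proj X (translation (t i) (incl A f))))
    (proj X (translation (t i) (incl A ((z - w).2 f))))]

theorem tendsto_comp_shift_zero (ht' : Tendsto t l cofinite)
    {F : RegionSpace X →L[ℂ] RegionSpace X}
    (hF : Tendsto (fun k => F (proj X (basisVec k))) cofinite (𝓝 0)) (f : LatticeL2) :
    Tendsto (fun i => F (proj X (translation (t i) f))) l (𝓝 0) := by
  have h1 : Tendsto (fun i => incl X (F (proj X (translation (t i) f)))) l (𝓝 0) := by
    refine tendsto_zero_of_dense (C := ‖F‖) (X := Set.univ)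
      (fun i => incl X ∘L F ∘L proj X ∘L translation (t i)) (fun i g => ?_) (fun q _ => ?_) ?_
    · change ‖incl X (F (proj X (translation (t i) g)))‖ ≤ _
      rw [norm_incl]
      refine F.le_opNorm_of_le ((norm_proj_le _ _).trans ?_)
      rw [norm_translation_apply]
    · simp only [ContinuousLinearMap.comp_apply, translation_basisVec]
      have h2 := ((incl X).continuous.tendsto 0).comp
        (hF.comp ((add_right_injective q).tendsto_cofinite.comp ht'))
      rw [map_zero] at h2
      exact h2
    · have h3 := lp.hasSum_single (E := fun _ : ℤ × ℤ => ℂ) (p := 2) (by norm_num) f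
      refine mem_closure_of_tendsto h3 (Eventually.of_forall fun S =>
        Submodule.sum_mem _ fun k _ => ?_)
      have : (lp.single 2 k (f k) : LatticeL2) = f k • basisVec k := by
        rw [basisVec, ← lp.single_smul]
        simp
      rw [this]
      exact Submodule.smul_mem _ _ (Submodule.subset_span ⟨k, Set.mem_univ k, rfl⟩)
  rw [tendsto_zero_iff_norm_tendsto_zero] at h1 ⊢
  exact h1

/-- Evaluate `S * z.1 = 1 + F` on far translates of `f`: the translates keep the norm of `f` in the
limit, `z.1` turns into `z.2`, and `F` contributes nothing. -/
theorem norm_le_of_leftInverse_mod [l.NeBot] (ht : ∀ p, ∀ᶠ i in l, (p + t i ∈ X ↔ p ∈ A))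
    (ht' : Tendsto t l cofinite)
    {z : (RegionSpace X →L[ℂ] RegionSpace X) × (RegionSpace A →L[ℂ] RegionSpace A)}
    (hz : z ∈ genGraph (compression X) (compression A))
    {S F : RegionSpace X →L[ℂ] RegionSpace X} (hS : S * z.1 = 1 + F)
    (hF : Tendsto (fun k => F (proj X (basisVec k))) cofinite (𝓝 0)) (f : RegionSpace A) :
    ‖f‖ ≤ ‖S‖ * ‖z.2 f‖ := by
  have h1 := (tendsto_intertwine ht hz f).norm.const_mul ‖S‖
  have h2 := (tendsto_comp_shift_zero ht' hF (incl A f)).norm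
  have h3 := (h1.add h2).const_add (‖S‖ * ‖z.2 f‖)
  rw [norm_zero (E := RegionSpace X), mul_zero, add_zero, add_zero] at h3
  refine le_of_tendsto_of_tendsto' (tendsto_norm_proj_translation ht f) h3 fun i => ?_
  set g := proj X (translation (t i) (incl A f)) with hg
  set g' := proj X (translation (t i) (incl A (z.2 f))) with hg'
  have e : g = S g' + (S (z.1 g - g') - F g) := by
    have := DFunLike.congr_fun hS g
    simp only [mul_apply_eq_comp, add_apply, one_apply_eq_self] at this
    rw [map_sub, this]
    abel
  calc ‖g‖ ≤ ‖S g'‖ + (‖S (z.1 g - g')‖ + ‖F g‖) := by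
        conv_lhs => rw [e]
        exact (norm_add_le _ _).trans (by gcongr; exact norm_sub_le _ _)
    _ ≤ _ := by
        gcongr
        · exact S.le_opNorm_of_le (norm_proj_translation_incl_le i _)
        · exact S.le_opNorm _

end Shift

/-! ### Decay of finite-range operators along the basis, and invertibility from lower bounds -/

theorem tendsto_inner_basisVec (f : LatticeL2) :
    Tendsto (fun k => ⟪f, basisVec k⟫_ℂ) cofinite (𝓝 0) := by
  have h := (lp.memℓp f).summable (by norm_num)
  have h1 := h.tendsto_cofinite_zero
  simp only [ENNReal.toReal_ofNat, Real.rpow_ofNat] at h1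
  have h2 := h1.sqrt
  simp only [Real.sqrt_sq (norm_nonneg _), Real.sqrt_zero] at h2
  rw [tendsto_zero_iff_norm_tendsto_zero]
  refine h2.congr fun k => ?_
  rw [basisVec, lp.inner_single_right]
  simp

/-- Expanding in an orthonormal basis of the range writes `F` as a finite sum of rank-one operators,
whose values on `e_k` are governed by coefficients of square summable functions. -/
theorem tendsto_basisVec_of_hasFiniteRange {X : Set (ℤ × ℤ)}
    {F : RegionSpace X →L[ℂ] RegionSpace X}
    (hF : (F : RegionSpace X →ₗ[ℂ] RegionSpace X).HasFiniteRange) :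
    Tendsto (fun k => F (proj X (basisVec k))) cofinite (𝓝 0) := by
  have hfd : FiniteDimensional ℂ (F : RegionSpace X →ₗ[ℂ] RegionSpace X).range :=
    Module.Finite.of_fg hF.fg_range
  set b := stdOrthonormalBasis ℂ (F : RegionSpace X →ₗ[ℂ] RegionSpace X).range
  have h1 : ∀ g, F g = ∑ i, ⟪ContinuousLinearMap.adjoint F (b i : RegionSpace X), g⟫_ℂ •
      (b i : RegionSpace X) := by
    intro g
    have := congrArg Subtype.val (b.sum_repr' (⟨F g, g, rfl⟩ :
      (F : RegionSpace X →ₗ[ℂ] RegionSpace X).range))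
    refine this.symm.trans ?_
    simp [ContinuousLinearMap.adjoint_inner_left]
  have h2 : ∀ g : RegionSpace X, ∀ k, ⟪g, proj X (basisVec k)⟫_ℂ = ⟪incl X g, basisVec k⟫_ℂ := by
    intro g k
    rw [← adjoint_incl, ContinuousLinearMap.adjoint_inner_right]
  have h3 : Tendsto (fun k => ∑ i, ⟪incl X (ContinuousLinearMap.adjoint F (b i : RegionSpace X)),
      basisVec k⟫_ℂ • (b i : RegionSpace X)) cofinite
      (𝓝 (∑ i, (0 : ℂ) • (b i : RegionSpace X))) :=
    tendsto_finsetSum _ fun i _ => (tendsto_inner_basisVec _).smul_const _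
  simp only [zero_smul, Finset.sum_const_zero] at h3
  refine h3.congr fun k => ?_
  rw [h1]
  simp only [h2]

/-- The range of the adjoint need not be examined: `F * star F` has finite range, and `‖star F g‖ ^
2 = ‖⟪(F * star F) g, g⟫‖ ≤ ‖(F * star F) g‖` when `‖g‖ ≤ 1`. -/
theorem tendsto_adjoint_basisVec_of_hasFiniteRange {X : Set (ℤ × ℤ)}
    {F : RegionSpace X →L[ℂ] RegionSpace X}
    (hF : (F : RegionSpace X →ₗ[ℂ] RegionSpace X).HasFiniteRange) :
    Tendsto (fun k => star F (proj X (basisVec k))) cofinite (𝓝 0) := by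
  have h := tendsto_basisVec_of_hasFiniteRange (F := F * star F)
    (hF.comp_right (star F : RegionSpace X →L[ℂ] RegionSpace X).toLinearMap)
  have h1 : Tendsto (fun k => Real.sqrt ‖(F * star F) (proj X (basisVec k))‖) cofinite (𝓝 0) := by
    simpa using h.norm.sqrt
  refine squeeze_zero_norm (fun k => Real.le_sqrt_of_sq_le ?_) h1
  have h2 : ‖proj X (basisVec k)‖ ≤ 1 :=
    (norm_proj_le _ _).trans (by rw [basisVec, lp.norm_single (by norm_num)]; simp)
  set g := proj X (basisVec k)
  have h3 : ‖star F g‖ ^ 2 = ‖⟪(F * star F) g, g⟫_ℂ‖ := by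
    rw [mul_apply_eq_comp, ← ContinuousLinearMap.adjoint_inner_right,
      ← ContinuousLinearMap.star_eq_adjoint, inner_self_eq_norm_sq_to_K]
    simp
  rw [h3]
  refine (norm_inner_le_norm _ _).trans ?_
  exact mul_le_of_le_one_right (norm_nonneg _) h2

/-- A lower bound for `b` makes `star b * b` coercive, hence invertible. Applied to `a` and to `star
a`, this yields a left and a right inverse of `a`. -/
theorem isUnit_of_forall_norm_le {H : Type*} [NormedAddCommGroup H] [InnerProductSpace ℂ H]
    [CompleteSpace H] {a : H →L[ℂ] H} {C C' : ℝ} (h : ∀ f, ‖f‖ ≤ C * ‖a f‖)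
    (h' : ∀ f, ‖f‖ ≤ C' * ‖star a f‖) : IsUnit a := by
  have key : ∀ (b : H →L[ℂ] H) (C : ℝ), (∀ f, ‖f‖ ≤ C * ‖b f‖) → IsUnit (star b * b) := by
    intro b C hb
    refine ContinuousLinearMap.isUnit_of_forall_le_norm_inner_map _
      -- The sign of `C` is not known; `|C| + 1` is a positive constant that serves equally well.
      (c := ((‖C‖₊ + 1) ^ 2)⁻¹) (by positivity) fun f => ?_
    rw [mul_apply_eq_comp, ContinuousLinearMap.star_eq_adjoint,
      ContinuousLinearMap.adjoint_inner_left, inner_self_eq_norm_sq_to_K]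
    simp only [norm_pow, RCLike.norm_ofReal, abs_norm, NNReal.coe_inv, NNReal.coe_pow,
      NNReal.coe_add, NNReal.coe_one, coe_nnnorm, Real.norm_eq_abs]
    rw [mul_inv_le_iff₀ (by positivity), ← mul_pow]
    refine pow_le_pow_left₀ (norm_nonneg _) ((hb f).trans ?_) 2
    rw [mul_comm]
    gcongr
    linarith [le_abs_self C]
  have h1 := key a C h
  have h2 := key (star a) C' h'
  rw [star_star] at h2
  exact isUnit_iff_exists_and_exists.mpr
    ⟨⟨star a * ↑h2.unit⁻¹, by rw [← mul_assoc]; exact h2.mul_val_inv⟩,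
      ⟨↑h1.unit⁻¹ * star a, by rw [mul_assoc]; exact h1.val_inv_mul⟩⟩

theorem isUnit_of_isFredholm {X A : Set (ℤ × ℤ)}
    (h : ∀ S : Finset (ℤ × ℤ), ∃ t : ℤ × ℤ, ∀ p ∈ S, (p + t ∈ X ↔ p ∈ A) ∧ p + t ≠ 0)
    {z : (RegionSpace X →L[ℂ] RegionSpace X) × (RegionSpace A →L[ℂ] RegionSpace A)}
    (hz : z ∈ genGraph (compression X) (compression A)) (hT : z.1.IsFredholm) : IsUnit z.2 := by
  choose t ht using h
  have hev : ∀ p, ∀ᶠ S in (atTop : Filter (Finset (ℤ × ℤ))),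
      (p + t S ∈ X ↔ p ∈ A) ∧ p + t S ≠ 0 := by
    intro p
    filter_upwards [eventually_ge_atTop {p}] with S hS
    exact ht S p (hS (Finset.mem_singleton_self p))
  have h1 : ∀ p, ∀ᶠ S in (atTop : Filter (Finset (ℤ × ℤ))), (p + t S ∈ X ↔ p ∈ A) :=
    fun p => (hev p).mono fun _ h => h.1
  -- Avoiding the origin forces the translations to infinity: `-p + t S ≠ 0` says exactly `t S ≠ p`.
  have h2 : Tendsto t atTop cofinite := by
    refine le_cofinite_iff_eventually_ne.mpr ?_
    intro p
    rw [eventually_map]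
    filter_upwards [hev (-p)] with S hS hp
    exact hS.2 (by rw [hp, neg_add_cancel])
  obtain ⟨v, hv1, hv2⟩ := hT.exists_isQuasiInverse
  refine isUnit_of_forall_norm_le (C := ‖v‖) (C' := ‖star v‖)
    (norm_le_of_leftInverse_mod h1 h2 hz (F := v * z.1 - 1) (by abel)
      (tendsto_basisVec_of_hasFiniteRange ?_))
    (norm_le_of_leftInverse_mod h1 h2 (star_mem hz) (F := star (z.1 * v - 1)) ?_
      (tendsto_adjoint_basisVec_of_hasFiniteRange ?_))
  · exact LinearMap.FiniteRangeSetoid.equiv_iff_hasFiniteRange.mp hv1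
  · simp
  · exact LinearMap.FiniteRangeSetoid.equiv_iff_hasFiniteRange.mp hv2

/-! ### Fredholmness from invertibility of the symbols -/

section Fredholm

variable {E : Type*} [NormedAddCommGroup E] [NormedSpace ℂ E] [CompleteSpace E]

/-- Units are open, so `K` may be replaced by a nearby finite-range operator. -/
theorem exists_hasFiniteRange_isUnit_add {S K : E →L[ℂ] E} (hK : K ∈ approxFiniteRange E E)
    (h : IsUnit (S + K)) :
    ∃ F : E →L[ℂ] E, (F : E →ₗ[ℂ] E).HasFiniteRange ∧ IsUnit (S + F) := by
  obtain ⟨ε, hε, hball⟩ := Metric.isOpen_iff.mp (Units.isOpen (R := E →L[ℂ] E)) _ h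
  obtain ⟨F, hF, hKF⟩ := exists_hasFiniteRange_norm_sub_lt hK hε
  refine ⟨F, hF, hball ?_⟩
  rwa [Metric.mem_ball', dist_eq_norm, add_sub_add_left_eq_sub]

open scoped LinearMap.FiniteRangeSetoid in
theorem isFredholm_of_left_of_right {T L R K K' : E →L[ℂ] E} (hK : K ∈ approxFiniteRange E E)
    (hK' : K' ∈ approxFiniteRange E E) (hL : IsUnit (L * T + K)) (hR : IsUnit (T * R + K')) :
    T.IsFredholm := by
  obtain ⟨F, hF, hL⟩ := exists_hasFiniteRange_isUnit_add hK hL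
  obtain ⟨F', hF', hR⟩ := exists_hasFiniteRange_isUnit_add hK' hR
  set G : E →L[ℂ] E := ↑hL.unit⁻¹
  set G' : E →L[ℂ] E := ↑hR.unit⁻¹
  have h1 : G * L * T - 1 = -(G * F) := by
    have : G * (L * T + F) = 1 := hL.val_inv_mul
    rw [← this]
    noncomm_ring
  have h2 : T * (R * G') - 1 = -(F' * G') := by
    have : (T * R + F') * G' = 1 := hR.mul_val_inv
    rw [← this]
    noncomm_ring
  have h3 : ((T * (G * L) - 1 : E →L[ℂ] E) : E →ₗ[ℂ] E).HasFiniteRange := by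
    -- The usual argument that a left inverse equals a right inverse, carried out modulo finite
    -- range: `G * L` is a left inverse and `R * G'` a right inverse, so `G * L` is also a right
    -- inverse.
    have e : T * (G * L) - 1 = T * (G * L * T - 1) * (R * G') - T * (G * L) * (T * (R * G') - 1) +
        (T * (R * G') - 1) := by noncomm_ring
    rw [e, h1, h2]
    have a1 : ((T * -(G * F) * (R * G') : E →L[ℂ] E) : E →ₗ[ℂ] E).HasFiniteRange :=
      ((hF.comp_left (G : E →ₗ[ℂ] E)).neg.comp_left (T : E →ₗ[ℂ] E)).comp_right
        ((R * G' : E →L[ℂ] E) : E →ₗ[ℂ] E)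
    have a2 : ((-(F' * G') : E →L[ℂ] E) : E →ₗ[ℂ] E).HasFiniteRange :=
      (hF'.comp_right (G' : E →ₗ[ℂ] E)).neg
    have a3 : ((T * (G * L) * -(F' * G') : E →L[ℂ] E) : E →ₗ[ℂ] E).HasFiniteRange :=
      a2.comp_left ((T * (G * L) : E →L[ℂ] E) : E →ₗ[ℂ] E)
    exact (a1.sub a3).add a2
  refine ContinuousLinearMap.IsFredholm.of_isQuasiInverse (v := G * L) ⟨?_, ?_⟩
  · refine LinearMap.FiniteRangeSetoid.equiv_iff_hasFiniteRange.mpr ?_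
    change ((G * L * T - 1 : E →L[ℂ] E) : E →ₗ[ℂ] E).HasFiniteRange
    rw [h1]
    exact (hF.comp_left (G : E →ₗ[ℂ] E)).neg
  · exact LinearMap.FiniteRangeSetoid.equiv_iff_hasFiniteRange.mpr h3

end Fredholm

/-- Closedness makes the Toeplitz algebra a C*-algebra in its own right, giving functional calculus
and spectral permanence inside it. -/
instance (X : Set (ℤ × ℤ)) : IsClosed (toeplitzAlgebra X : Set (RegionSpace X →L[ℂ] RegionSpace X)) :=
  StarSubalgebra.isClosed_topologicalClosure _

/-- If two `*`-homomorphisms map `star x * x` to invertible elements, then `star x * x` is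
invertible up to an element of both kernels. -/
theorem exists_isUnit_star_mul_self_add {A B C : Type*} [CStarAlgebra A] [CStarAlgebra B]
    [CStarAlgebra C] (φ : A →⋆ₐ[ℂ] B) (ψ : A →⋆ₐ[ℂ] C) (hφ : Continuous φ) (hψ : Continuous ψ)
    {x : A} (hx : IsUnit (φ (star x * x))) (hx' : IsUnit (ψ (star x * x))) :
    ∃ k : A, φ k = 0 ∧ ψ k = 0 ∧ IsUnit (star x * x + k) := by
  have hU : IsOpen ((spectrum ℝ (φ (star x * x)))ᶜ ∩ (spectrum ℝ (ψ (star x * x)))ᶜ) :=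
    (spectrum.isClosed _).isOpen_compl.inter (spectrum.isClosed _).isOpen_compl
  -- Both image spectra are closed and omit `0`, so a ball of radius `c` about `0` misses them. The
  -- tent `κ` lives on that ball: it vanishes on both image spectra, while `r + κ r ≥ c` for every
  -- `r ≥ 0`.
  obtain ⟨c, hc, hball⟩ := Metric.isOpen_iff.mp hU 0
    ⟨spectrum.zero_notMem ℝ hx, spectrum.zero_notMem ℝ hx'⟩
  set κ : ℝ → ℝ := fun r => max (c - |r|) 0 with hκ
  have hκc : Continuous κ := by fun_prop
  have hvanish : ∀ r, r ∉ Metric.ball (0 : ℝ) c → κ r = 0 := by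
    intro r hr
    rw [Metric.mem_ball, dist_zero_right, Real.norm_eq_abs] at hr
    exact max_eq_right (by linarith)
  have hsa : IsSelfAdjoint (star x * x) := .star_mul_self x
  refine ⟨cfc κ (star x * x), ?_, ?_, ?_⟩
  · rw [φ.map_cfc κ (star x * x) hκc.continuousOn hφ hsa (hsa.map φ),
      cfc_congr (g := 0) fun r hr => hvanish r fun hrc => (hball hrc).1 hr]
    exact cfc_zero ℝ _
  · rw [ψ.map_cfc κ (star x * x) hκc.continuousOn hψ hsa (hsa.map ψ),
      cfc_congr (g := 0) fun r hr => hvanish r fun hrc => (hball hrc).2 hr]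
    exact cfc_zero ℝ _
  · have e : star x * x + cfc κ (star x * x) = cfc (fun r => r + κ r) (star x * x) := by
      rw [cfc_add (star x * x) (fun r => r) κ continuousOn_id hκc.continuousOn, cfc_id' ℝ _ hsa]
    rw [e, isUnit_cfc_iff (fun r => r + κ r) _ (continuous_id.add hκc).continuousOn hsa]
    intro r hr
    have hr0 : 0 ≤ r := spectrum_star_mul_self_nonneg r hr
    rcases lt_or_ge r c with h | h
    · have : c - |r| ≤ κ r := le_max_left _ _
      rw [abs_of_nonneg hr0] at this
      linarith
    · have : 0 ≤ κ r := le_max_right _ _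
      linarith

/-! ### The half-plane symbols of the concave corner algebra -/

section Gamma

variable {α β : EReal} (hαβ : α < β) (hne : ¬(α = ⊥ ∧ β = ⊤))

theorem gammaAbove_graph (T : ConcaveToeplitz α β) :
    ((T : RegionSpace (concaveCorner α β) →L[ℂ] RegionSpace (concaveCorner α β)),
      (gammaAbove hαβ hne T : RegionSpace (halfPlaneAbove α) →L[ℂ] RegionSpace (halfPlaneAbove α))) ∈
      genGraph (compression (concaveCorner α β)) (compression (halfPlaneAbove α)) :=
  extendHom_graph (shiftsTo_corner_above hαβ hne).norm_le T

theorem gammaBelow_graph (T : ConcaveToeplitz α β) :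
    ((T : RegionSpace (concaveCorner α β) →L[ℂ] RegionSpace (concaveCorner α β)),
      (gammaBelow hαβ hne T : RegionSpace (halfPlaneBelow β) →L[ℂ] RegionSpace (halfPlaneBelow β))) ∈
      genGraph (compression (concaveCorner α β)) (compression (halfPlaneBelow β)) :=
  extendHom_graph (shiftsTo_corner_below hαβ hne).norm_le T

theorem mem_approxFiniteRange_of_gamma_eq_zero {T : ConcaveToeplitz α β}
    (hA : gammaAbove hαβ hne T = 0) (hB : gammaBelow hαβ hne T = 0) :
    (T : RegionSpace (concaveCorner α β) →L[ℂ] RegionSpace (concaveCorner α β)) ∈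
      approxFiniteRange _ _ := by
  have hgA := gammaAbove_graph hαβ hne T
  have hgB := gammaBelow_graph hαβ hne T
  rw [hA] at hgA
  rw [hB] at hgB
  have hdet := normals_independent hαβ hne
  have hmA := mem_halfPlaneAbove α
  have hmB := mem_halfPlaneBelow β
  generalize (if α = ⊥ then (1 : ℝ) else -α.toReal) = u₁ at hdet hmA
  generalize (if α = ⊥ then (0 : ℝ) else 1) = u₂ at hdet hmA
  generalize (if β = ⊤ then (1 : ℝ) else β.toReal) = v₁ at hdet hmB
  generalize (if β = ⊤ then (0 : ℝ) else -1) = v₂ at hdet hmB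
  refine mem_approxFiniteRange_of_genGraph_zero
    -- The corner is cut where the two defining forms agree. On `D` the form of the upper half-plane
    -- dominates, so a far point can see the edge of that half-plane only; `D'` is symmetric.
    (D := {k ∈ concaveCorner α β | v₁ * k.1 + v₂ * k.2 ≤ u₁ * k.1 + u₂ * k.2})
    (D' := {k ∈ concaveCorner α β | ¬ v₁ * k.1 + v₂ * k.2 ≤ u₁ * k.1 + u₂ * k.2})
    ?_ ?_ ?_ ?_ hgA hgB
  · ext k
    rw [Set.mem_union, Set.mem_ofPred_eq, Set.mem_ofPred_eq, ← and_or_left]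
    exact and_iff_left (em _)
  · exact Set.disjoint_left.mpr fun k h h' => h'.2 h.2
  · exact finite_not_mem_union_iff u₁ u₂ v₁ v₂ hdet hmA hmB fun k hk => hk
  · rw [concaveCorner, Set.union_comm]
    exact finite_not_mem_union_iff v₁ v₂ u₁ u₂ (fun h => hdet (by linarith)) hmB hmA
      fun k hk => ⟨hk.1, (not_le.mp hk.2).le⟩

theorem isFredholm_of_isUnit_gamma {T : ConcaveToeplitz α β} (hA : IsUnit (gammaAbove hαβ hne T))
    (hB : IsUnit (gammaBelow hαβ hne T)) :
    (T : RegionSpace (concaveCorner α β) →L[ℂ] RegionSpace (concaveCorner α β)).IsFredholm := by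
  have hcA := continuous_restrictHom (shiftsTo_corner_above hαβ hne)
  have hcB := continuous_restrictHom (shiftsTo_corner_below hαβ hne)
  obtain ⟨k, hkA, hkB, hk⟩ := exists_isUnit_star_mul_self_add (gammaAbove hαβ hne)
    (gammaBelow hαβ hne) hcA hcB (x := T) (by rw [map_mul, map_star]; exact hA.star.mul hA)
    (by rw [map_mul, map_star]; exact hB.star.mul hB)
  obtain ⟨k', hkA', hkB', hk'⟩ := exists_isUnit_star_mul_self_add (gammaAbove hαβ hne)
    (gammaBelow hαβ hne) hcA hcB (x := star T)
    (by rw [star_star, map_mul, map_star]; exact hA.mul hA.star)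
    (by rw [star_star, map_mul, map_star]; exact hB.mul hB.star)
  rw [star_star] at hk'
  -- The adjoint of `T` serves as both `L` and `R`; the kernel corrections `k` and `k'` are the
  -- admissible errors.
  exact isFredholm_of_left_of_right (mem_approxFiniteRange_of_gamma_eq_zero hαβ hne hkA hkB)
    (mem_approxFiniteRange_of_gamma_eq_zero hαβ hne hkA' hkB')
    (hk.map (toeplitzAlgebra (concaveCorner α β)).subtype)
    (hk'.map (toeplitzAlgebra (concaveCorner α β)).subtype)

theorem isUnit_gammaAbove_of_isFredholm {T : ConcaveToeplitz α β}
    (hT : (T : RegionSpace (concaveCorner α β) →L[ℂ] RegionSpace (concaveCorner α β)).IsFredholm) :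
    IsUnit (gammaAbove hαβ hne T) := by
  -- Spectral permanence: invertibility as an operator on the half-plane space suffices.
  refine (StarSubalgebra.coe_isUnit (toeplitzAlgebra (halfPlaneAbove α))).mp
    (isUnit_of_isFredholm (fun S => ?_) (gammaAbove_graph hαβ hne T) hT)
  obtain ⟨t, ht⟩ := exists_shift _ _ _ _ (normals_independent hαβ hne) S
  refine ⟨t, fun p hp => ⟨?_, fun h0 => ?_⟩⟩
  · rw [concaveCorner, Set.mem_union, mem_halfPlaneAbove, mem_halfPlaneBelow, mem_halfPlaneAbove,
      (ht p hp).1]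
    exact or_iff_left (not_le.mpr (ht p hp).2)
  -- The form of the other half-plane is strictly negative at `p + t`, whereas it vanishes at the
  -- origin.
  · have := (ht p hp).2
    rw [h0] at this
    simp at this

theorem isUnit_gammaBelow_of_isFredholm {T : ConcaveToeplitz α β}
    (hT : (T : RegionSpace (concaveCorner α β) →L[ℂ] RegionSpace (concaveCorner α β)).IsFredholm) :
    IsUnit (gammaBelow hαβ hne T) := by
  refine (StarSubalgebra.coe_isUnit (toeplitzAlgebra (halfPlaneBelow β))).mp
    (isUnit_of_isFredholm (fun S => ?_) (gammaBelow_graph hαβ hne T) hT)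
  obtain ⟨t, ht⟩ := exists_shift (if β = ⊤ then 1 else β.toReal) (if β = ⊤ then 0 else -1)
    (if α = ⊥ then 1 else -α.toReal) (if α = ⊥ then 0 else 1)
    (fun h => normals_independent hαβ hne (by linarith)) S
  refine ⟨t, fun p hp => ⟨?_, fun h0 => ?_⟩⟩
  · rw [concaveCorner, Set.mem_union, mem_halfPlaneAbove, mem_halfPlaneBelow, mem_halfPlaneBelow,
      (ht p hp).1]
    exact or_iff_right (not_le.mpr (ht p hp).2)
  · have := (ht p hp).2
    rw [h0] at this
    simp at this

theorem isUnit_gamma_iff (T : ConcaveToeplitz α β) : IsUnit (gamma hαβ hne T) ↔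
    IsUnit (gammaAbove hαβ hne T) ∧ IsUnit (gammaBelow hαβ hne T) := by
  refine ⟨fun h => ?_, fun ⟨hA, hB⟩ => ?_⟩
  · have h' : IsUnit (gammaAbove hαβ hne T, gammaBelow hαβ hne T) :=
      h.map (pullbackAlgebra α β).subtype
    exact Prod.isUnit_iff.mp h'
  · have hT : sigmaAbove α (gammaAbove hαβ hne T) = sigmaBelow β (gammaBelow hαβ hne T) :=
      DFunLike.congr_fun (sigma_comp_gamma hαβ hne) T
    obtain ⟨a, ha⟩ := hA
    obtain ⟨b, hb⟩ := hB
    -- The images of `a⁻¹` and `b⁻¹` on the torus are a left and a right inverse of the same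
    -- function, hence equal.
    have hinv : ((↑a⁻¹, ↑b⁻¹) : ToeplitzAbove α × ToeplitzBelow β) ∈ pullbackAlgebra α β := by
      change sigmaAbove α ↑a⁻¹ = sigmaBelow β ↑b⁻¹
      rw [← ha, ← hb] at hT
      refine left_inv_eq_right_inv (a := sigmaAbove α a) ?_ ?_
      · rw [← map_mul, Units.inv_mul, map_one]
      · rw [hT, ← map_mul, Units.mul_inv, map_one]
    refine isUnit_iff_exists.mpr ⟨⟨_, hinv⟩, Subtype.ext (Prod.ext ?_ ?_),
      Subtype.ext (Prod.ext ?_ ?_)⟩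
    · change gammaAbove hαβ hne T * ↑a⁻¹ = 1
      rw [← ha, Units.mul_inv]
    · change gammaBelow hαβ hne T * ↑b⁻¹ = 1
      rw [← hb, Units.mul_inv]
    · change ↑a⁻¹ * gammaAbove hαβ hne T = 1
      rw [← ha, Units.inv_mul]
    · change ↑b⁻¹ * gammaBelow hαβ hne T = 1
      rw [← hb, Units.inv_mul]

end Gamma

end ConcaveCorner

end

theorem theorem2p6 {α β : EReal} (hαβ : α < β) (hne : ¬(α = ⊥ ∧ β = ⊤))
    (T : ConcaveCorner.ConcaveToeplitz α β) :
    ((T : ConcaveCorner.RegionSpace (ConcaveCorner.concaveCorner α β) →L[ℂ]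
          ConcaveCorner.RegionSpace (ConcaveCorner.concaveCorner α β)).IsFredholm ↔
        IsUnit (ConcaveCorner.gamma hαβ hne T)) ∧
      (IsUnit (ConcaveCorner.gamma hαβ hne T) ↔
        IsUnit (ConcaveCorner.gammaAbove hαβ hne T) ∧
          IsUnit (ConcaveCorner.gammaBelow hαβ hne T)) := by
  refine ⟨?_, ConcaveCorner.isUnit_gamma_iff hαβ hne T⟩
  rw [ConcaveCorner.isUnit_gamma_iff]
  exact ⟨fun h => ⟨ConcaveCorner.isUnit_gammaAbove_of_isFredholm hαβ hne h,
    ConcaveCorner.isUnit_gammaBelow_of_isFredholm hαβ hne h⟩,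
    fun h => ConcaveCorner.isFredholm_of_isUnit_gamma hαβ hne h.1 h.2⟩
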